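/- **Counter-example to the planar reflection property for surfaces.** For two smoothly parametrized surfaces $\phi_1,\phi_2$ in $\mathbb R^3$ with normal fields $N_i=(\phi_i)_{u}\times(\phi_i)_{v}$, and points $p_i=\phi_i(u_i,v_i)$, put $M=\frac{p_1+p_2}{2}$, $C=\frac{p_1-p_2}{2}$ and $$F(p_1,p_2,X)=\big((N_2\cdot C)N_1+(N_1\cdot C)N_2\big)\cdot(X-M),$$ so that $F(p_1,p_2,\cdot)=0$ is the mid-plane of $(p_1,p_2)$, the plane containing $M$ and the intersection of the tangent planes at $p_1$ and $p_2$. The pair $(p_1,p_2)$ *generates* $X$ if its tangent planes are transversal and $F=0$, $F_{p_1}=0$, $F_{p_2}=0$ at $(p_1,p_2,X)$; the envelope of mid-hyperplanes (EMH) of the two surfaces is the set of all points generated by pairs $(p_1,p_2)$. Let $\lambda\neq0$, let $I\subset(0,\infty)$ be a non-empty open interval and $f:I\to\mathbb R$ a $C^\infty$ function with $f\neq0$, $f'f''>0$ and $t-\lambda f(t)>0$ on $I$. Rotating the convex curve $\gamma_1(t)=(t,0,f(t))$ and its affine reflection $\gamma_2(t)=(t-\lambda f(t),0,-f(t))$ about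 the $z$-axis gives the (locally convex, non-degenerate) surfaces $S_1$, $S_2$ parametrized on $I\times\mathbb R$ by $$\phi_1(t,\theta)=(t\cos\theta,t\sin\theta,f(t)),\qquad \phi_2(t,\theta)=((t-\lambda f(t))\cos\theta,(t-\lambda f(t))\sin\theta,-f(t)).$$ (a) For all such $\lambda$, $I$, $f$: (i) if the tangent planes at the corresponding points $\phi_1(t,\theta)$ and $\phi_2(t,\theta)$ are transversal, then the mid-plane of this pair is the plane $z=0$; (ii) if this pair generates a point $X$ of the EMH at which the Hessian of $F$ with respect to the four surface parameters is non-degenerate, then there is an open neighbourhood $V\subset I\times\mathbb R$ of $(t,\theta)$ such that the EMH of $\phi_1(V)$ and $\phi_2(V)$ is contained in the plane $z=0$; (iii) no affine reflection of $\mathbb R^3$ (an affine involution whose fixed point set is a plane) maps $S_1$ onto $S_2$. (b) For every $\lambda\neq0$ there are such $I$ and $f$ for which all tangent planes of $S_1$ are transversal to all tangent planes of $S_2$, every pair of corresponding points generates a point of the EMH, and the whole EMH of $S_1$ and $S_2$ is contained in the plane $z=0$, although no affine reflection maps $S_1$ onto $S_2$. Hence, unlike for planar curves, the inclusion of the EMH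 of a pair of surfaces in a plane does not imply that an affine reflection takes one surface to the other. -/

import Mathlib

open scoped ContDiff Matrix

noncomputable section

namespace MidHyperplanes

/-- Real affine three-space. Only its affine structure, the cross product and the dot product
are used. -/
abbrev Vec3 := Fin 3 → ℝ

/-- The tangent space (a vector subspace) of the parametrized surface `φ` at the parameter `u`. -/
def tangentSpace (φ : ℝ × ℝ → Vec3) (u : ℝ × ℝ) : Submodule ℝ Vec3 :=
  LinearMap.range (fderiv ℝ φ u).toLinearMap

/-- The tangent spaces of `φ₁` and `φ₂` at the two parameters are transversal. -/
def Transversal (φ₁ φ₂ : ℝ × ℝ → Vec3) (w : (ℝ × ℝ) × (ℝ × ℝ)) : Prop :=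
  tangentSpace φ₁ w.1 ⊔ tangentSpace φ₂ w.2 = ⊤

/-- A normal vector (the coefficient vector of a conormal functional) of the parametrized
surface `φ`: the cross product of the two coordinate vectors. -/
def normal (φ : ℝ × ℝ → Vec3) (u : ℝ × ℝ) : Vec3 :=
  crossProduct (fderiv ℝ φ u (1, 0)) (fderiv ℝ φ u (0, 1))

/-- The mid-point `M` of a pair of points. -/
def midPoint (φ₁ φ₂ : ℝ × ℝ → Vec3) (w : (ℝ × ℝ) × (ℝ × ℝ)) : Vec3 :=
  (1 / 2 : ℝ) • (φ₁ w.1 + φ₂ w.2)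

/-- The mid-chord `C` of a pair of points. -/
def midChord (φ₁ φ₂ : ℝ × ℝ → Vec3) (w : (ℝ × ℝ) × (ℝ × ℝ)) : Vec3 :=
  (1 / 2 : ℝ) • (φ₁ w.1 - φ₂ w.2)

/-- The defining function `F(p₁, p₂, X) = ((N₂ · C) N₁ + (N₁ · C) N₂) · (X - M)` of the
mid-planes. For a fixed pair it is affine in `X` and vanishes at `M` and on the intersection of
the two affine tangent planes. -/
def midPlaneFun (φ₁ φ₂ : ℝ × ℝ → Vec3) (w : (ℝ × ℝ) × (ℝ × ℝ)) (X : Vec3) : ℝ :=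
  ((normal φ₂ w.2 ⬝ᵥ midChord φ₁ φ₂ w) • normal φ₁ w.1 +
    (normal φ₁ w.1 ⬝ᵥ midChord φ₁ φ₂ w) • normal φ₂ w.2) ⬝ᵥ (X - midPoint φ₁ φ₂ w)

/-- The mid-plane of a pair of points: the plane through their mid-point and the intersection of
their tangent planes. -/
def midPlane (φ₁ φ₂ : ℝ × ℝ → Vec3) (w : (ℝ × ℝ) × (ℝ × ℝ)) : Set Vec3 :=
  {X | midPlaneFun φ₁ φ₂ w X = 0}

/-- The pair of points with parameters `w` has transversal tangent planes and generates the
point `X` of the envelope of mid-planes: `F = F_{p₁} = F_{p₂} = 0`. -/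
def Generates (φ₁ φ₂ : ℝ × ℝ → Vec3) (w : (ℝ × ℝ) × (ℝ × ℝ)) (X : Vec3) : Prop :=
  Transversal φ₁ φ₂ w ∧ midPlaneFun φ₁ φ₂ w X = 0 ∧
    fderiv ℝ (fun w' => midPlaneFun φ₁ φ₂ w' X) w = 0

/-- The envelope of mid-planes (EMH) of the surface pieces `φ₁(D₁)` and `φ₂(D₂)`, where `D₁` and
`D₂` are open parameter domains: all points generated by pairs of points with transversal tangent
planes. -/
def EMH (φ₁ φ₂ : ℝ × ℝ → Vec3) (D₁ D₂ : Set (ℝ × ℝ)) : Set Vec3 :=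
  {X | ∃ u₁ ∈ D₁, ∃ u₂ ∈ D₂, Generates φ₁ φ₂ (u₁, u₂) X}

/-- The Hessian of `F(·, ·, X)` with respect to the four surface parameters is non-degenerate
(the condition `Δ ≠ 0`). -/
def HessianNondegenerate (φ₁ φ₂ : ℝ × ℝ → Vec3) (w : (ℝ × ℝ) × (ℝ × ℝ)) (X : Vec3) : Prop :=
  Function.Injective (fderiv ℝ (fderiv ℝ (fun w' => midPlaneFun φ₁ φ₂ w' X)) w)

/-- An affine reflection of three-space: an affine involution whose set of fixed points is a
plane. -/
def IsAffineReflection (R : Vec3 →ᵃ[ℝ] Vec3) : Prop :=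
  (∀ x, R (R x) = x) ∧
    ∃ H : AffineSubspace ℝ Vec3, (H : Set Vec3).Nonempty ∧ Module.finrank ℝ H.direction = 2 ∧
      ∀ x, R x = x ↔ x ∈ H

/-- `φ₁(t, θ)`: the curve `γ₁(t) = (t, 0, f t)` rotated about the `z`-axis by the angle `θ`. -/
def rotSurface₁ (f : ℝ → ℝ) (u : ℝ × ℝ) : Vec3 :=
  ![u.1 * Real.cos u.2, u.1 * Real.sin u.2, f u.1]

/-- `φ₂(t, θ)`: the curve `γ₂(t) = (t - lam * f t, 0, -f t)`, which is the image of `γ₁` under the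
affine reflection `(x, z) ↦ (x - lam * z, -z)` of the `xz`-plane, rotated about the `z`-axis by
the angle `θ`. -/
def rotSurface₂ (f : ℝ → ℝ) (lam : ℝ) (u : ℝ × ℝ) : Vec3 :=
  ![(u.1 - lam * f u.1) * Real.cos u.2, (u.1 - lam * f u.1) * Real.sin u.2, -f u.1]

/-- The parameter domain: the curve parameter runs through `I`, the angle through `ℝ`. -/
def rotDomain (I : Set ℝ) : Set (ℝ × ℝ) := I ×ˢ Set.univ

/-- Data for the construction: `γ₁` is the graph of a smooth function `f` on a non-empty open
interval `I`, the curves `γ₁` and `γ₂` stay on the side `x > 0` of the axis of rotation, and `γ₁`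
does not meet the axis of reflection `z = 0`. The Gauss curvatures of the two rotational surfaces
have the sign of `f' * f''`, so the last condition says that both are non-degenerate and locally
convex; in particular `γ₁` is convex. -/
structure ConvexProfile (I : Set ℝ) (f : ℝ → ℝ) (lam : ℝ) : Prop where
  isOpen : IsOpen I
  nonempty : I.Nonempty
  ordConnected : I.OrdConnected
  smooth : ContDiffOn ℝ ∞ f I
  pos₁ : ∀ t ∈ I, 0 < t
  pos₂ : ∀ t ∈ I, 0 < t - lam * f t
  ne_zero : ∀ t ∈ I, f t ≠ 0
  convex : ∀ t ∈ I, 0 < deriv f t * deriv (deriv f) t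

end MidHyperplanes

end

noncomputable section

namespace MidHyperplanes

open Real Filter Topology

/-! Everything starts from the diagonal: with `h = lam * f` and the third coordinate of `X` scaled
by `lam`, the function `F` equals, up to a non-vanishing factor, a function `redFun` free of `lam`,
and at a pair of corresponding points this is `h * (2 - h') ^ 2 * X 2`. Transversality gives `2 - h'
≠ 0`, so the mid-plane is `z = 0`.

Local statement (`eventually_critical_mem_plane`). Consider the map sending a pair `(u₁, u₂)` and a
point `X` to `u₁`, the horizontal coordinates of `X`, the value `F` and the derivative of `F` along
the diagonal directions `(e, e)`. Since `F` vanishes on the diagonal for points of the plane, a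
non-degenerate Hessian has a non-degenerate off-diagonal block, and this makes the map an immersion,
hence injective nearby. A nearby critical triple and the triple formed by `(u₁, u₁)` and the
horizontal projection of `X` have the same image, so they coincide and `X 2 = 0`. This needs `X` to
be close to the given point. For a fixed pair the generation conditions are linear in `X`
(`critForm`), and existence of a generated point over the diagonal forces it to be unique, so by a
compactness argument the points generated by neighbouring pairs are close to it
(`eventually_generated_mem_nhds`).

No reflection (`no_affineReflection`). If an affine involution `R` exchanges the surfaces,
conjugating the rotations about the `z`-axis by `R` gives affine motions preserving both surfaces.
Their generator is an affine field tangent to both, and integrating the tangency conditions along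
the profiles shows that `R` respects the axis and the horizontal directions. Comparing heights and
radii then yields `lam * f = 0` at some point.

Global example (`exists_global_example`). For a suitable quadratic `h` near the parameter `1`, two
points over `1` with different angles generate nothing, not even at infinity, which is an open
condition; equal angles are covered by the local argument. Compactness of the circle of angle
differences gives one interval that works for all of them. -/

theorem fderiv_apply_of_hasDerivAt_fst {E : Type*} [NormedAddCommGroup E] [NormedSpace ℝ E]
    {φ : ℝ × ℝ → E} {u : ℝ × ℝ} (hφ : DifferentiableAt ℝ φ u) {v : E}
    (h : HasDerivAt (fun r => φ (r, u.2)) v u.1) : fderiv ℝ φ u (1, 0) = v := by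
  have h1 : HasDerivAt (fun r : ℝ => (r, u.2)) ((1 : ℝ), (0 : ℝ)) u.1 :=
    (hasDerivAt_id _).prodMk (hasDerivAt_const _ _)
  exact (HasFDerivAt.comp_hasDerivAt (f := fun r : ℝ => (r, u.2)) u.1
    hφ.hasFDerivAt h1).unique h

theorem fderiv_apply_of_hasDerivAt_snd {E : Type*} [NormedAddCommGroup E] [NormedSpace ℝ E]
    {φ : ℝ × ℝ → E} {u : ℝ × ℝ} (hφ : DifferentiableAt ℝ φ u) {v : E}
    (h : HasDerivAt (fun r => φ (u.1, r)) v u.2) : fderiv ℝ φ u (0, 1) = v := by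
  have h1 : HasDerivAt (fun r : ℝ => (u.1, r)) ((0 : ℝ), (1 : ℝ)) u.2 :=
    (hasDerivAt_const _ _).prodMk (hasDerivAt_id _)
  exact (HasFDerivAt.comp_hasDerivAt (f := fun r : ℝ => (u.1, r)) u.2
    hφ.hasFDerivAt h1).unique h

/-! ### Surfaces of rotation and their normals -/

/-- The surface obtained by rotating the curve `(ρ, 0, ζ)` about the `z`-axis. -/
def rotCurve (ρ ζ : ℝ → ℝ) (u : ℝ × ℝ) : Vec3 := ![ρ u.1 * cos u.2, ρ u.1 * sin u.2, ζ u.1]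

theorem rotSurface₁_eq_rotCurve (f : ℝ → ℝ) : rotSurface₁ f = rotCurve (fun t => t) f := rfl

theorem rotSurface₂_eq_rotCurve (f : ℝ → ℝ) (lam : ℝ) :
    rotSurface₂ f lam = rotCurve (fun t => t - lam * f t) (fun t => -f t) := rfl

section rotCurve
variable {ρ ζ : ℝ → ℝ} {u : ℝ × ℝ} {ρ' ζ' : ℝ}

theorem differentiableAt_rotCurve (hρ : HasDerivAt ρ ρ' u.1) (hζ : HasDerivAt ζ ζ' u.1) :
    DifferentiableAt ℝ (rotCurve ρ ζ) u := by
  have h1 : DifferentiableAt ℝ (fun u : ℝ × ℝ => ρ u.1) u :=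
    hρ.differentiableAt.comp u differentiableAt_fst
  have h2 : DifferentiableAt ℝ (fun u : ℝ × ℝ => ζ u.1) u :=
    hζ.differentiableAt.comp u differentiableAt_fst
  rw [differentiableAt_pi]
  intro i
  fin_cases i
  · exact h1.mul (by fun_prop)
  · exact h1.mul (by fun_prop)
  · exact h2

theorem fderiv_rotCurve_fst (hρ : HasDerivAt ρ ρ' u.1) (hζ : HasDerivAt ζ ζ' u.1) :
    fderiv ℝ (rotCurve ρ ζ) u (1, 0) = ![ρ' * cos u.2, ρ' * sin u.2, ζ'] := by
  refine fderiv_apply_of_hasDerivAt_fst (differentiableAt_rotCurve hρ hζ) ?_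
  rw [hasDerivAt_pi]
  intro i
  fin_cases i
  · simpa [rotCurve] using hρ.mul_const (cos u.2)
  · simpa [rotCurve] using hρ.mul_const (sin u.2)
  · simpa [rotCurve] using hζ

theorem fderiv_rotCurve_snd (hρ : HasDerivAt ρ ρ' u.1) (hζ : HasDerivAt ζ ζ' u.1) :
    fderiv ℝ (rotCurve ρ ζ) u (0, 1) = ![-(ρ u.1 * sin u.2), ρ u.1 * cos u.2, 0] := by
  refine fderiv_apply_of_hasDerivAt_snd (differentiableAt_rotCurve hρ hζ) ?_
  rw [hasDerivAt_pi]
  intro i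
  fin_cases i
  · simpa [rotCurve] using (hasDerivAt_cos u.2).const_mul (ρ u.1)
  · simpa [rotCurve] using (hasDerivAt_sin u.2).const_mul (ρ u.1)
  · simpa [rotCurve] using hasDerivAt_const u.2 (ζ u.1)

theorem normal_rotCurve (hρ : HasDerivAt ρ ρ' u.1) (hζ : HasDerivAt ζ ζ' u.1) :
    normal (rotCurve ρ ζ) u =
      ![-(ρ u.1 * ζ' * cos u.2), -(ρ u.1 * ζ' * sin u.2), ρ u.1 * ρ'] := by
  rw [normal, fderiv_rotCurve_fst hρ hζ, fderiv_rotCurve_snd hρ hζ, cross_apply]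
  have := sin_sq_add_cos_sq u.2
  ext i
  fin_cases i
  · simp; ring
  · simp; ring
  · simp; linear_combination ρ u.1 * ρ' * this

end rotCurve

/-! ### The reduced defining function of the mid-planes -/

/-- The coefficient of the second tangent plane in the reduced defining function of the mid-planes,
for `h = lam * f` and with the third coordinate of the point scaled by `lam`. -/
def redP (h : ℝ → ℝ) (w : (ℝ × ℝ) × (ℝ × ℝ)) : ℝ :=
  -deriv h w.1.1 * (w.1.1 - (w.2.1 - h w.2.1) * cos (w.1.2 - w.2.2)) + h w.1.1 + h w.2.1

/-- The coefficient of the first tangent plane in the reduced defining function; see `redP`. -/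
def redQ (h : ℝ → ℝ) (w : (ℝ × ℝ) × (ℝ × ℝ)) : ℝ :=
  deriv h w.2.1 * (w.1.1 * cos (w.1.2 - w.2.2) - (w.2.1 - h w.2.1)) +
    (1 - deriv h w.2.1) * (h w.1.1 + h w.2.1)

/-- The equation of the tangent plane of the first surface. -/
def redL₁ (h : ℝ → ℝ) (w : (ℝ × ℝ) × (ℝ × ℝ)) (X : Vec3) : ℝ :=
  -deriv h w.1.1 * (X 0 * cos w.1.2 + X 1 * sin w.1.2 - w.1.1) + X 2 - h w.1.1

/-- The equation of the tangent plane of the second surface. -/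
def redL₂ (h : ℝ → ℝ) (w : (ℝ × ℝ) × (ℝ × ℝ)) (X : Vec3) : ℝ :=
  deriv h w.2.1 * (X 0 * cos w.2.2 + X 1 * sin w.2.2 - (w.2.1 - h w.2.1)) +
    (1 - deriv h w.2.1) * (X 2 + h w.2.1)

/-- The function defining the mid-planes, up to a non-vanishing factor. -/
def redFun (h : ℝ → ℝ) (w : (ℝ × ℝ) × (ℝ × ℝ)) (X : Vec3) : ℝ :=
  redQ h w * redL₁ h w X + redP h w * redL₂ h w X

/-- Scaling of the third coordinate. -/
def scaleThird (lam : ℝ) (X : Vec3) : Vec3 := ![X 0, X 1, lam * X 2]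

theorem normal_rotSurface₁ {f : ℝ → ℝ} {s : ℝ} (α : ℝ) (h : DifferentiableAt ℝ f s) :
    normal (rotSurface₁ f) (s, α) = ![-(s * deriv f s * cos α), -(s * deriv f s * sin α), s] := by
  rw [rotSurface₁_eq_rotCurve]
  simpa using normal_rotCurve (u := (s, α)) (hasDerivAt_id' s) h.hasDerivAt

theorem normal_rotSurface₂ {f : ℝ → ℝ} (lam : ℝ) {t : ℝ} (β : ℝ) (h : DifferentiableAt ℝ f t) :
    normal (rotSurface₂ f lam) (t, β) =
      ![(t - lam * f t) * deriv f t * cos β, (t - lam * f t) * deriv f t * sin β,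
        (t - lam * f t) * (1 - lam * deriv f t)] := by
  rw [rotSurface₂_eq_rotCurve]
  refine (normal_rotCurve (u := (t, β)) ((hasDerivAt_id' t).sub (h.hasDerivAt.const_mul lam))
    h.hasDerivAt.neg).trans ?_
  simp

section products
variable {f : ℝ → ℝ} {lam s t : ℝ}

theorem normal_dotProduct_midChord₁ (hlam : lam ≠ 0) (α β : ℝ)
    (h : DifferentiableAt ℝ f s) :
    normal (rotSurface₁ f) (s, α) ⬝ᵥ
      midChord (rotSurface₁ f) (rotSurface₂ f lam) ((s, α), (t, β)) =
      s / (2 * lam) * redP (fun t => lam * f t) ((s, α), (t, β)) := by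
  rw [normal_rotSurface₁ α h]
  simp [midChord, redP, deriv_const_mul lam h, cos_sub, rotSurface₁, rotSurface₂, dotProduct,
    Fin.sum_univ_three]
  field_simp
  linear_combination (-deriv f s * s ^ 2) * sin_sq_add_cos_sq α

theorem normal_dotProduct_midChord₂ (hlam : lam ≠ 0) (α β : ℝ)
    (h : DifferentiableAt ℝ f t) :
    normal (rotSurface₂ f lam) (t, β) ⬝ᵥ
      midChord (rotSurface₁ f) (rotSurface₂ f lam) ((s, α), (t, β)) =
      (t - lam * f t) / (2 * lam) * redQ (fun t => lam * f t) ((s, α), (t, β)) := by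
  rw [normal_rotSurface₂ lam β h]
  simp [midChord, redQ, deriv_const_mul lam h, cos_sub, rotSurface₁, rotSurface₂, dotProduct,
    Fin.sum_univ_three]
  field_simp
  linear_combination (-deriv f t * (t - lam * f t) ^ 2) * sin_sq_add_cos_sq β

theorem normal_dotProduct_sub_midPoint₁ (hlam : lam ≠ 0) (α β : ℝ)
    (h : DifferentiableAt ℝ f s) (X : Vec3) :
    normal (rotSurface₁ f) (s, α) ⬝ᵥ
      (X - midPoint (rotSurface₁ f) (rotSurface₂ f lam) ((s, α), (t, β))) =
      s / lam * (redL₁ (fun t => lam * f t) ((s, α), (t, β)) (scaleThird lam X) +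
        redP (fun t => lam * f t) ((s, α), (t, β)) / 2) := by
  rw [normal_rotSurface₁ α h]
  simp [midPoint, redP, redL₁, scaleThird, deriv_const_mul lam h, cos_sub, rotSurface₁,
    rotSurface₂, dotProduct, Fin.sum_univ_three]
  field_simp
  linear_combination (deriv f s * s ^ 2) * sin_sq_add_cos_sq α

theorem normal_dotProduct_sub_midPoint₂ (hlam : lam ≠ 0) (α β : ℝ)
    (h : DifferentiableAt ℝ f t) (X : Vec3) :
    normal (rotSurface₂ f lam) (t, β) ⬝ᵥ
      (X - midPoint (rotSurface₁ f) (rotSurface₂ f lam) ((s, α), (t, β))) =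
      (t - lam * f t) / lam * (redL₂ (fun t => lam * f t) ((s, α), (t, β)) (scaleThird lam X) -
        redQ (fun t => lam * f t) ((s, α), (t, β)) / 2) := by
  rw [normal_rotSurface₂ lam β h]
  simp [midPoint, redQ, redL₂, scaleThird, deriv_const_mul lam h, cos_sub, rotSurface₁,
    rotSurface₂, dotProduct, Fin.sum_univ_three]
  field_simp
  linear_combination (-deriv f t * (t - lam * f t) ^ 2) * sin_sq_add_cos_sq β

end products

/-- With `X - M = (X - p₁) + C = (X - p₂) - C`, the contributions of `C` to the two summands cancel:
`Q * (L₁ + P / 2) + P * (L₂ - Q / 2) = Q * L₁ + P * L₂`. Only the lengths of the normals and powers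
of `lam` remain as a factor. -/
theorem midPlaneFun_rotSurface {f : ℝ → ℝ} {lam : ℝ} (hlam : lam ≠ 0)
    {w : (ℝ × ℝ) × (ℝ × ℝ)} (h1 : DifferentiableAt ℝ f w.1.1) (h2 : DifferentiableAt ℝ f w.2.1)
    (X : Vec3) :
    midPlaneFun (rotSurface₁ f) (rotSurface₂ f lam) w X =
      w.1.1 * (w.2.1 - lam * f w.2.1) / (2 * lam ^ 2) *
        redFun (fun t => lam * f t) w (scaleThird lam X) := by
  obtain ⟨⟨s, α⟩, ⟨t, β⟩⟩ := w
  dsimp only at h1 h2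
  rw [midPlaneFun, add_dotProduct, smul_dotProduct, smul_dotProduct,
    normal_dotProduct_midChord₁ hlam α β h1, normal_dotProduct_midChord₂ hlam α β h2,
    normal_dotProduct_sub_midPoint₁ hlam α β h1, normal_dotProduct_sub_midPoint₂ hlam α β h2,
    redFun]
  simp only [smul_eq_mul]
  generalize redP _ _ = p, redQ _ _ = q, redL₁ _ _ _ = l, redL₂ _ _ _ = m
  field_simp
  ring

theorem contDiffAt_deriv {h : ℝ → ℝ} {t : ℝ} (hh : ContDiffAt ℝ ∞ h t) :
    ContDiffAt ℝ ∞ (deriv h) t := by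
  have h1 : ContDiffAt ℝ ∞ (fderiv ℝ h) t := hh.fderiv_right (by simp)
  exact h1.clm_apply contDiffAt_const

theorem contDiffAt_uncurry_redFun {h : ℝ → ℝ} {w : (ℝ × ℝ) × (ℝ × ℝ)}
    (h1 : ContDiffAt ℝ ∞ h w.1.1) (h2 : ContDiffAt ℝ ∞ h w.2.1) (X : Vec3) :
    ContDiffAt ℝ ∞ (Function.uncurry (redFun h)) (w, X) := by
  have a1 : ContDiffAt ℝ ∞ (fun q : ((ℝ × ℝ) × (ℝ × ℝ)) × Vec3 => h q.1.1.1) (w, X) :=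
    h1.comp (w, X) (g := h) (f := fun q => q.1.1.1) (by fun_prop)
  have a2 : ContDiffAt ℝ ∞ (fun q : ((ℝ × ℝ) × (ℝ × ℝ)) × Vec3 => h q.1.2.1) (w, X) :=
    h2.comp (w, X) (g := h) (f := fun q => q.1.2.1) (by fun_prop)
  have b1 : ContDiffAt ℝ ∞ (fun q : ((ℝ × ℝ) × (ℝ × ℝ)) × Vec3 => deriv h q.1.1.1) (w, X) :=
    (contDiffAt_deriv h1).comp (w, X) (g := deriv h) (f := fun q => q.1.1.1)
      (by fun_prop)
  have b2 : ContDiffAt ℝ ∞ (fun q : ((ℝ × ℝ) × (ℝ × ℝ)) × Vec3 => deriv h q.1.2.1) (w, X) :=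
    (contDiffAt_deriv h2).comp (w, X) (g := deriv h) (f := fun q => q.1.2.1) (by fun_prop)
  unfold Function.uncurry redFun redQ redP redL₁ redL₂
  fun_prop

/-! ### First derivatives and critical points -/

/-- The derivative of `redFun` with respect to the first curve parameter. -/
def redPartS (h : ℝ → ℝ) (w : (ℝ × ℝ) × (ℝ × ℝ)) (X : Vec3) : ℝ :=
  (deriv h w.2.1 * cos (w.1.2 - w.2.2) + (1 - deriv h w.2.1) * deriv h w.1.1) * redL₁ h w X -
    redQ h w * (deriv (deriv h) w.1.1 * (X 0 * cos w.1.2 + X 1 * sin w.1.2 - w.1.1)) -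
    deriv (deriv h) w.1.1 * (w.1.1 - (w.2.1 - h w.2.1) * cos (w.1.2 - w.2.2)) * redL₂ h w X

/-- The derivative of `redFun` with respect to the second curve parameter. -/
def redPartT (h : ℝ → ℝ) (w : (ℝ × ℝ) × (ℝ × ℝ)) (X : Vec3) : ℝ :=
  deriv (deriv h) w.2.1 * (w.1.1 * cos (w.1.2 - w.2.2) - (w.2.1 - h w.2.1) -
    (h w.1.1 + h w.2.1)) * redL₁ h w X +
  (deriv h w.1.1 * (1 - deriv h w.2.1) * cos (w.1.2 - w.2.2) + deriv h w.2.1) * redL₂ h w X +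
  redP h w * (deriv (deriv h) w.2.1 * (X 0 * cos w.2.2 + X 1 * sin w.2.2 - (w.2.1 - h w.2.1) -
    (X 2 + h w.2.1)))

/-- The common term of the derivatives of `redFun` with respect to the two angles. -/
def redTwist (h : ℝ → ℝ) (w : (ℝ × ℝ) × (ℝ × ℝ)) (X : Vec3) : ℝ :=
  sin (w.1.2 - w.2.2) * (deriv h w.2.1 * w.1.1 * redL₁ h w X +
    deriv h w.1.1 * (w.2.1 - h w.2.1) * redL₂ h w X)

/-- The derivative of `redFun` with respect to the first angle. -/
def redPartα (h : ℝ → ℝ) (w : (ℝ × ℝ) × (ℝ × ℝ)) (X : Vec3) : ℝ :=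
  -redTwist h w X - redQ h w * deriv h w.1.1 * (-(X 0 * sin w.1.2) + X 1 * cos w.1.2)

/-- The derivative of `redFun` with respect to the second angle. -/
def redPartβ (h : ℝ → ℝ) (w : (ℝ × ℝ) × (ℝ × ℝ)) (X : Vec3) : ℝ :=
  redTwist h w X + redP h w * deriv h w.2.1 * (-(X 0 * sin w.2.2) + X 1 * cos w.2.2)

section partials
variable {h : ℝ → ℝ} {s α t β : ℝ}

theorem hasDerivAt_redPartS (h1 : ContDiffAt ℝ ∞ h s) (X : Vec3) :
    HasDerivAt (fun r => redFun h ((r, α), (t, β)) X) (redPartS h ((s, α), (t, β)) X) s := by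
  have d0 := (h1.differentiableAt (by simp)).hasDerivAt
  have d1 := ((contDiffAt_deriv h1).differentiableAt (by simp)).hasDerivAt
  have i := hasDerivAt_id' s
  have dP := ((d1.neg.mul (i.sub_const ((t - h t) * cos (α - β)))).add d0).add_const (h t)
  have dQ := (((i.mul_const (cos (α - β))).sub_const (t - h t)).const_mul (deriv h t)).add
    ((d0.add_const (h t)).const_mul (1 - deriv h t))
  have dL := ((d1.neg.mul (i.const_sub (X 0 * cos α + X 1 * sin α))).add_const (X 2)).sub d0
  refine ((dQ.mul dL).add (dP.mul_const (redL₂ h ((s, α), (t, β)) X))).congr_deriv ?_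
  simp only [redPartS, redQ, redL₁, Pi.neg_apply, Pi.mul_apply, Pi.add_apply, Pi.sub_apply]
  generalize redL₂ _ _ _ = l
  ring

theorem hasDerivAt_redPartT (h2 : ContDiffAt ℝ ∞ h t) (X : Vec3) :
    HasDerivAt (fun r => redFun h ((s, α), (r, β)) X) (redPartT h ((s, α), (t, β)) X) t := by
  have d0 := (h2.differentiableAt (by simp)).hasDerivAt
  have d1 := ((contDiffAt_deriv h2).differentiableAt (by simp)).hasDerivAt
  have i := hasDerivAt_id' t
  have dg := i.sub d0
  have dP := ((((dg.mul_const (cos (α - β))).const_sub s).const_mul (-deriv h s)).add_const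
    (h s)).add d0
  have dQ := (d1.mul (dg.const_sub (s * cos (α - β)))).add
    ((d1.const_sub 1).mul (d0.const_add (h s)))
  have dL := (d1.mul (dg.const_sub (X 0 * cos β + X 1 * sin β))).add
    ((d1.const_sub 1).mul (d0.const_add (X 2)))
  refine ((dQ.mul_const (redL₁ h ((s, α), (t, β)) X)).add (dP.mul dL)).congr_deriv ?_
  simp only [redPartT, redP, redL₂, Pi.mul_apply, Pi.add_apply, Pi.sub_apply]
  generalize redL₁ _ _ _ = l
  ring

theorem hasDerivAt_redPartα (X : Vec3) :
    HasDerivAt (fun r => redFun h ((s, r), (t, β)) X) (redPartα h ((s, α), (t, β)) X) α := by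
  have dc := ((hasDerivAt_id' α).sub_const β).cos
  have dP := (((dc.const_mul (t - h t)).const_sub s).const_mul (-deriv h s)).add_const
    (h s) |>.add_const (h t)
  have dQ := ((dc.const_mul s).sub_const (t - h t)).const_mul (deriv h t) |>.add_const
    ((1 - deriv h t) * (h s + h t))
  have dL := (((((hasDerivAt_cos α).const_mul (X 0)).add
    ((hasDerivAt_sin α).const_mul (X 1))).sub_const s).const_mul (-deriv h s)).add_const (X 2)
    |>.sub_const (h s)
  refine ((dQ.mul dL).add (dP.mul_const (redL₂ h ((s, α), (t, β)) X))).congr_deriv ?_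
  simp only [redPartα, redTwist, redQ, redL₁, Pi.add_apply]
  generalize redL₂ _ _ _ = l
  ring

theorem hasDerivAt_redPartβ (X : Vec3) :
    HasDerivAt (fun r => redFun h ((s, α), (t, r)) X) (redPartβ h ((s, α), (t, β)) X) β := by
  have dc := ((hasDerivAt_id' β).const_sub α).cos
  have dP := (((dc.const_mul (t - h t)).const_sub s).const_mul (-deriv h s)).add_const
    (h s) |>.add_const (h t)
  have dQ := ((dc.const_mul s).sub_const (t - h t)).const_mul (deriv h t) |>.add_const
    ((1 - deriv h t) * (h s + h t))
  have dL := (((((hasDerivAt_cos β).const_mul (X 0)).add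
    ((hasDerivAt_sin β).const_mul (X 1))).sub_const (t - h t)).const_mul (deriv h t)).add_const
      ((1 - deriv h t) * (X 2 + h t))
  refine ((dQ.mul_const (redL₁ h ((s, α), (t, β)) X)).add (dP.mul dL)).congr_deriv ?_
  simp only [redPartβ, redTwist, redP, redL₂, Pi.add_apply]
  generalize redL₁ _ _ _ = l
  ring

end partials

theorem differentiableAt_redFun {h : ℝ → ℝ} {w : (ℝ × ℝ) × (ℝ × ℝ)}
    (h1 : ContDiffAt ℝ ∞ h w.1.1) (h2 : ContDiffAt ℝ ∞ h w.2.1) (X : Vec3) :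
    DifferentiableAt ℝ (fun w => redFun h w X) w :=
  ((contDiffAt_uncurry_redFun h1 h2 X).differentiableAt (by simp)).comp w
    (f := fun w => (w, X)) (by fun_prop)

theorem fderiv_redFun_apply {h : ℝ → ℝ} {w : (ℝ × ℝ) × (ℝ × ℝ)}
    (h1 : ContDiffAt ℝ ∞ h w.1.1) (h2 : ContDiffAt ℝ ∞ h w.2.1) (X : Vec3)
    (d : (ℝ × ℝ) × (ℝ × ℝ)) :
    fderiv ℝ (fun w => redFun h w X) w d = d.1.1 * redPartS h w X + d.1.2 * redPartα h w X +
      (d.2.1 * redPartT h w X + d.2.2 * redPartβ h w X) := by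
  obtain ⟨⟨s, α⟩, ⟨t, β⟩⟩ := w
  have hd := (differentiableAt_redFun h1 h2 X).hasFDerivAt
  have es := (hd.comp_hasDerivAt (f := fun r : ℝ => ((r, α), (t, β))) s
    (((hasDerivAt_id s).prodMk (hasDerivAt_const _ _)).prodMk (hasDerivAt_const _ _))).unique
    (hasDerivAt_redPartS h1 X)
  have eα := (hd.comp_hasDerivAt (f := fun r : ℝ => ((s, r), (t, β))) α
    (((hasDerivAt_const _ _).prodMk (hasDerivAt_id α)).prodMk (hasDerivAt_const _ _))).unique
    (hasDerivAt_redPartα X)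
  have et := (hd.comp_hasDerivAt (f := fun r : ℝ => ((s, α), (r, β))) t
    ((hasDerivAt_const _ _).prodMk ((hasDerivAt_id t).prodMk (hasDerivAt_const _ _)))).unique
    (hasDerivAt_redPartT h2 X)
  have eβ := (hd.comp_hasDerivAt (f := fun r : ℝ => ((s, α), (t, r))) β
    ((hasDerivAt_const _ _).prodMk ((hasDerivAt_const _ _).prodMk (hasDerivAt_id β)))).unique
    (hasDerivAt_redPartβ X)
  have hdec : d = d.1.1 • (((1 : ℝ), (0 : ℝ)), (0 : ℝ × ℝ)) +
      d.1.2 • (((0 : ℝ), (1 : ℝ)), (0 : ℝ × ℝ)) + (d.2.1 • ((0 : ℝ × ℝ), ((1 : ℝ), (0 : ℝ))) +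
      d.2.2 • ((0 : ℝ × ℝ), ((0 : ℝ), (1 : ℝ)))) := by
    ext <;> simp
  rw [← es, ← eα, ← et, ← eβ]
  conv_lhs => rw [hdec]
  simp only [map_add, map_smul, smul_eq_mul]

/-- By the product rule, at a zero of `R` the derivative of `m * R` is `m` times that of `R`. This
discards the factor relating `midPlaneFun` to `redFun`. -/
theorem critical_iff_of_eventuallyEq_mul {E : Type*} [NormedAddCommGroup E] [NormedSpace ℝ E]
    {F m R : E → ℝ} {w : E} (hF : F =ᶠ[𝓝 w] fun v => m v * R v) (hm : DifferentiableAt ℝ m w)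
    (hR : DifferentiableAt ℝ R w) (hm0 : m w ≠ 0) :
    (F w = 0 ∧ fderiv ℝ F w = 0) ↔ (R w = 0 ∧ fderiv ℝ R w = 0) := by
  have h1 : F w = m w * R w := hF.eq_of_nhds
  have h2 : fderiv ℝ F w = m w • fderiv ℝ R w + R w • fderiv ℝ m w :=
    hF.fderiv_eq.trans (fderiv_fun_mul hm hR)
  rw [h1, h2, mul_eq_zero, or_iff_right hm0]
  refine and_congr_right fun h0 => ?_
  rw [h0, zero_smul, add_zero, smul_eq_zero, or_iff_right hm0]

/-- The non-vanishing factor by which the defining function differs from the reduced one. -/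
def redFactor (f : ℝ → ℝ) (lam : ℝ) (w : (ℝ × ℝ) × (ℝ × ℝ)) : ℝ :=
  w.1.1 * (w.2.1 - lam * f w.2.1) / (2 * lam ^ 2)

theorem eventually_midPlaneFun_eq {f : ℝ → ℝ} {lam : ℝ} (hlam : lam ≠ 0)
    {w : (ℝ × ℝ) × (ℝ × ℝ)} (h1 : ContDiffAt ℝ ∞ f w.1.1) (h2 : ContDiffAt ℝ ∞ f w.2.1) :
    ∀ᶠ v in 𝓝 w, ∀ X, midPlaneFun (rotSurface₁ f) (rotSurface₂ f lam) v X =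
      redFactor f lam v * redFun (fun t => lam * f t) v (scaleThird lam X) := by
  have e1 : ∀ᶠ r in 𝓝 w.1.1, DifferentiableAt ℝ f r :=
    ((h1.of_le (m := 1) (by simp)).eventually (by simp)).mono
      fun r hr => hr.differentiableAt (by simp)
  have e2 : ∀ᶠ r in 𝓝 w.2.1, DifferentiableAt ℝ f r :=
    ((h2.of_le (m := 1) (by simp)).eventually (by simp)).mono
      fun r hr => hr.differentiableAt (by simp)
  have c1 : Tendsto (fun v : (ℝ × ℝ) × (ℝ × ℝ) => v.1.1) (𝓝 w) (𝓝 w.1.1) :=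
    Continuous.tendsto (by fun_prop) w
  have c2 : Tendsto (fun v : (ℝ × ℝ) × (ℝ × ℝ) => v.2.1) (𝓝 w) (𝓝 w.2.1) :=
    Continuous.tendsto (by fun_prop) w
  filter_upwards [c1.eventually e1, c2.eventually e2] with v hv1 hv2 X
  exact midPlaneFun_rotSurface hlam hv1 hv2 X

theorem contDiffAt_redFactor {f : ℝ → ℝ} (lam : ℝ) {w : (ℝ × ℝ) × (ℝ × ℝ)}
    (h2 : ContDiffAt ℝ ∞ f w.2.1) : ContDiffAt ℝ ∞ (redFactor f lam) w := by
  have a2 : ContDiffAt ℝ ∞ (fun q : (ℝ × ℝ) × (ℝ × ℝ) => f q.2.1) w :=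
    h2.comp w (g := f) (f := fun q => q.2.1) (by fun_prop)
  unfold redFactor
  fun_prop

theorem critical_midPlaneFun_iff {f : ℝ → ℝ} {lam : ℝ} (hlam : lam ≠ 0)
    {w : (ℝ × ℝ) × (ℝ × ℝ)} (h1 : ContDiffAt ℝ ∞ f w.1.1) (h2 : ContDiffAt ℝ ∞ f w.2.1)
    (hw1 : w.1.1 ≠ 0) (hw2 : w.2.1 - lam * f w.2.1 ≠ 0) (X : Vec3) :
    (midPlaneFun (rotSurface₁ f) (rotSurface₂ f lam) w X = 0 ∧
      fderiv ℝ (fun w' => midPlaneFun (rotSurface₁ f) (rotSurface₂ f lam) w' X) w = 0) ↔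
    (redFun (fun t => lam * f t) w (scaleThird lam X) = 0 ∧
      fderiv ℝ (fun w' => redFun (fun t => lam * f t) w' (scaleThird lam X)) w = 0) := by
  refine critical_iff_of_eventuallyEq_mul (m := redFactor f lam)
    (F := fun w' => midPlaneFun (rotSurface₁ f) (rotSurface₂ f lam) w' X)
    (R := fun w' => redFun (fun t => lam * f t) w' (scaleThird lam X))
    ((eventually_midPlaneFun_eq hlam h1 h2).mono fun v hv => hv X)
    ((contDiffAt_redFactor lam h2).differentiableAt (by simp))
    (differentiableAt_redFun (contDiffAt_const.mul h1) (contDiffAt_const.mul h2) _) ?_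
  unfold redFactor
  positivity

/-! ### The linear system for the generated points -/

/-- The homogenised linear system for the points generated by a pair whose curve parameters are
`p.1` and `p.2.1` and whose angles differ by `p.2.2`. The unknowns are the radial and the angular
coordinate, in the frame of the first point, the third coordinate and the homogenising one. -/
def critForm (h : ℝ → ℝ) (p : ℝ × ℝ × ℝ) : (ℝ × ℝ × ℝ × ℝ) →ₗ[ℝ] (ℝ × ℝ × ℝ × ℝ × ℝ) where
  toFun v :=
    let P := redP h ((p.1, p.2.2), (p.2.1, 0))
    let Q := redQ h ((p.1, p.2.2), (p.2.1, 0))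
    let r := cos p.2.2 * v.1 - sin p.2.2 * v.2.1
    let l₁ := -deriv h p.1 * (v.1 - p.1 * v.2.2.2) + v.2.2.1 - h p.1 * v.2.2.2
    let l₂ := deriv h p.2.1 * (r - (p.2.1 - h p.2.1) * v.2.2.2) +
      (1 - deriv h p.2.1) * (v.2.2.1 + h p.2.1 * v.2.2.2)
    let T := sin p.2.2 * (deriv h p.2.1 * p.1 * l₁ + deriv h p.1 * (p.2.1 - h p.2.1) * l₂)
    (Q * l₁ + P * l₂,
      (deriv h p.2.1 * cos p.2.2 + (1 - deriv h p.2.1) * deriv h p.1) * l₁ -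
        Q * (deriv (deriv h) p.1 * (v.1 - p.1 * v.2.2.2)) -
        deriv (deriv h) p.1 * (p.1 - (p.2.1 - h p.2.1) * cos p.2.2) * l₂,
      deriv (deriv h) p.2.1 * (p.1 * cos p.2.2 - (p.2.1 - h p.2.1) - (h p.1 + h p.2.1)) * l₁ +
        (deriv h p.1 * (1 - deriv h p.2.1) * cos p.2.2 + deriv h p.2.1) * l₂ +
        P * (deriv (deriv h) p.2.1 * (r - (p.2.1 - h p.2.1) * v.2.2.2 -
          (v.2.2.1 + h p.2.1 * v.2.2.2))),
      -T - Q * deriv h p.1 * v.2.1,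
      T + P * deriv h p.2.1 * (sin p.2.2 * v.1 + cos p.2.2 * v.2.1))
  map_add' v v' := by
    generalize redP _ _ = P, redQ _ _ = Q
    ext <;> simp <;> ring
  map_smul' c v := by
    generalize redP _ _ = P, redQ _ _ = Q
    ext <;> simp <;> ring

/-- The coordinates of a point in the frame rotated by the angle `α`, with homogenising
coordinate `1`. -/
def frameCoord (α : ℝ) (X : Vec3) : ℝ × ℝ × ℝ × ℝ :=
  (X 0 * cos α + X 1 * sin α, -(X 0 * sin α) + X 1 * cos α, X 2, 1)

/-- In the frame turned with the first point only the difference of the angles enters; `e1` and `e2`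
express the frame of the second point through that of the first. -/
theorem critForm_frameCoord (h : ℝ → ℝ) (w : (ℝ × ℝ) × (ℝ × ℝ)) (X : Vec3) :
    critForm h (w.1.1, w.2.1, w.1.2 - w.2.2) (frameCoord w.1.2 X) =
      (redFun h w X, redPartS h w X, redPartT h w X, redPartα h w X, redPartβ h w X) := by
  obtain ⟨⟨s, α⟩, ⟨t, β⟩⟩ := w
  have e1 : cos (α - β) * (X 0 * cos α + X 1 * sin α) -
      sin (α - β) * (-(X 0 * sin α) + X 1 * cos α) = X 0 * cos β + X 1 * sin β := by
    rw [cos_sub, sin_sub]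
    linear_combination (X 0 * cos β + X 1 * sin β) * sin_sq_add_cos_sq α
  have e2 : sin (α - β) * (X 0 * cos α + X 1 * sin α) +
      cos (α - β) * (-(X 0 * sin α) + X 1 * cos α) = -(X 0 * sin β) + X 1 * cos β := by
    rw [cos_sub, sin_sub]
    linear_combination (-(X 0 * sin β) + X 1 * cos β) * sin_sq_add_cos_sq α
  simp [critForm, frameCoord, redFun, redPartS, redPartT, redPartα, redPartβ, redTwist, redP,
    redQ, redL₁, redL₂, e1, e2]

theorem critical_redFun_iff {h : ℝ → ℝ} {w : (ℝ × ℝ) × (ℝ × ℝ)}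
    (h1 : ContDiffAt ℝ ∞ h w.1.1) (h2 : ContDiffAt ℝ ∞ h w.2.1) (X : Vec3) :
    (redFun h w X = 0 ∧ fderiv ℝ (fun w' => redFun h w' X) w = 0) ↔
      critForm h (w.1.1, w.2.1, w.1.2 - w.2.2) (frameCoord w.1.2 X) = 0 := by
  rw [critForm_frameCoord]
  simp only [Prod.mk_eq_zero]
  refine and_congr_right fun _ => ⟨fun h0 => ?_, fun h0 => ?_⟩
  · have key := fun d => fderiv_redFun_apply h1 h2 X d
    rw [h0] at key
    have k1 := key ((1, 0), (0, 0))
    have k2 := key ((0, 0), (1, 0))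
    have k3 := key ((0, 1), (0, 0))
    have k4 := key ((0, 0), (0, 1))
    simp at k1 k2 k3 k4
    exact ⟨k1.symm, k2.symm, k3.symm, k4.symm⟩
  · refine ContinuousLinearMap.ext fun d => ?_
    obtain ⟨k1, k2, k3, k4⟩ := h0
    rw [fderiv_redFun_apply h1 h2 X d, k1, k2, k3, k4]
    simp

theorem continuousAt_critForm {h : ℝ → ℝ} {p : ℝ × ℝ × ℝ}
    (h1 : ContDiffAt ℝ ∞ h p.1) (h2 : ContDiffAt ℝ ∞ h p.2.1) (v : ℝ × ℝ × ℝ × ℝ) :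
    ContinuousAt (fun q : (ℝ × ℝ × ℝ) × (ℝ × ℝ × ℝ × ℝ) => critForm h q.1 q.2) (p, v) := by
  have c1 : Tendsto (fun q : (ℝ × ℝ × ℝ) × (ℝ × ℝ × ℝ × ℝ) => q.1.1) (𝓝 (p, v)) (𝓝 p.1) :=
    Continuous.tendsto (by fun_prop) (p, v)
  have c2 : Tendsto (fun q : (ℝ × ℝ × ℝ) × (ℝ × ℝ × ℝ × ℝ) => q.1.2.1) (𝓝 (p, v)) (𝓝 p.2.1) :=
    Continuous.tendsto (by fun_prop) (p, v)
  have a1 : ContinuousAt (fun q : (ℝ × ℝ × ℝ) × (ℝ × ℝ × ℝ × ℝ) => h q.1.1) (p, v) :=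
    h1.continuousAt.tendsto.comp c1
  have a2 : ContinuousAt (fun q : (ℝ × ℝ × ℝ) × (ℝ × ℝ × ℝ × ℝ) => h q.1.2.1) (p, v) :=
    h2.continuousAt.tendsto.comp c2
  have b1 : ContinuousAt (fun q : (ℝ × ℝ × ℝ) × (ℝ × ℝ × ℝ × ℝ) => deriv h q.1.1) (p, v) :=
    (contDiffAt_deriv h1).continuousAt.tendsto.comp c1
  have b2 : ContinuousAt (fun q : (ℝ × ℝ × ℝ) × (ℝ × ℝ × ℝ × ℝ) => deriv h q.1.2.1) (p, v) :=
    (contDiffAt_deriv h2).continuousAt.tendsto.comp c2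
  have d1 : ContinuousAt (fun q : (ℝ × ℝ × ℝ) × (ℝ × ℝ × ℝ × ℝ) => deriv (deriv h) q.1.1)
      (p, v) := (contDiffAt_deriv (contDiffAt_deriv h1)).continuousAt.tendsto.comp c1
  have d2 : ContinuousAt (fun q : (ℝ × ℝ × ℝ) × (ℝ × ℝ × ℝ × ℝ) => deriv (deriv h) q.1.2.1)
      (p, v) := (contDiffAt_deriv (contDiffAt_deriv h2)).continuousAt.tendsto.comp c2
  simp only [critForm, redP, redQ, LinearMap.coe_mk, AddHom.coe_mk]
  fun_prop

/-! ### Stability of linear systems and local injectivity -/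

section linearSystems
variable {A E F : Type*} [TopologicalSpace A] [NormedAddCommGroup E] [NormedSpace ℝ E]
  [FiniteDimensional ℝ E] [NormedAddCommGroup F] [NormedSpace ℝ F] {T : A → E →ₗ[ℝ] F} {a : A}

/-- By homogeneity it suffices to test unit vectors, and on the compact unit sphere non-vanishing is
an open condition in the parameter. -/
theorem eventually_ker_trivial
    (hT : ∀ v, ContinuousAt (fun q : A × E => T q.1 q.2) (a, v))
    (ha : ∀ v, T a v = 0 → v = 0) : ∀ᶠ b in 𝓝 a, ∀ v, T b v = 0 → v = 0 := by
  have h1 : ∀ᶠ b in 𝓝 a, ∀ v ∈ Metric.sphere (0 : E) 1, T b v ≠ 0 := by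
    refine (isCompact_sphere (0 : E) 1).eventually_forall_of_forall_eventually fun v hv => ?_
    refine (hT v).eventually_ne fun h0 => ?_
    have := ha v h0
    simp [this] at hv
  filter_upwards [h1] with b hb v hv
  by_contra hv0
  refine hb (‖v‖⁻¹ • v) ?_ ?_
  · simp [norm_smul, norm_ne_zero_iff.mpr hv0]
  · rw [map_smul, hv, smul_zero]

/-- Solutions of an affine system of linear equations depend semicontinuously on the
coefficients, provided that the limiting system has only one solution. -/
theorem eventually_ker_mem_nhds (ℓ : E →ₗ[ℝ] ℝ)
    (hT : ∀ v, ContinuousAt (fun q : A × E => T q.1 q.2) (a, v))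
    (ha : ∀ v, T a v = 0 → ℓ v = 0 → v = 0) {v₀ : E} (hv₀ : T a v₀ = 0) {N : Set E}
    (hN : N ∈ 𝓝 v₀) : ∀ᶠ b in 𝓝 a, ∀ v, T b v = 0 → ℓ v = ℓ v₀ → v ∈ N := by
  obtain ⟨r, hr, hrN⟩ := Metric.mem_nhds_iff.mp hN
  have hℓ : Continuous ℓ := ℓ.continuous_of_finiteDimensional
  -- A solution `v` at distance at least `r` from `v₀` gives the unit vector `e = (v - v₀) / ‖v -
  -- v₀‖` in the kernel of `ℓ` and the number `c = ‖v - v₀‖⁻¹` in `[0, r⁻¹]` with `T b e + c • T b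
  -- v₀ = 0`. At `b = a` the second term vanishes and the first does not; compactness extends this
  -- to nearby `b`.
  have hK : IsCompact ((Metric.sphere (0 : E) 1 ∩ {v | ℓ v = 0}) ×ˢ Set.Icc (0 : ℝ) r⁻¹) :=
    ((isCompact_sphere (0 : E) 1).inter_right (isClosed_eq hℓ continuous_const)).prod
      isCompact_Icc
  have h1 : ∀ᶠ b in 𝓝 a, ∀ q ∈ (Metric.sphere (0 : E) 1 ∩ {v | ℓ v = 0}) ×ˢ Set.Icc (0 : ℝ) r⁻¹,
      T b q.1 + q.2 • T b v₀ ≠ 0 := by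
    refine hK.eventually_forall_of_forall_eventually fun q hq => ?_
    have c1 : ContinuousAt (fun z : A × E × ℝ => T z.1 z.2.1) (a, q) :=
      ContinuousAt.comp (g := fun q : A × E => T q.1 q.2) (f := fun z : A × E × ℝ => (z.1, z.2.1))
        (hT q.1) (Continuous.continuousAt (by fun_prop))
    have c2 : ContinuousAt (fun z : A × E × ℝ => T z.1 v₀) (a, q) :=
      ContinuousAt.comp (g := fun q : A × E => T q.1 q.2) (f := fun z : A × E × ℝ => (z.1, v₀))
        (hT v₀) (Continuous.continuousAt (by fun_prop))
    have c3 : ContinuousAt (fun z : A × E × ℝ => z.2.2) (a, q) :=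
      Continuous.continuousAt (by fun_prop)
    refine (c1.add (c3.smul c2)).eventually_ne ?_
    intro h0
    change T a q.1 + q.2 • T a v₀ = 0 at h0
    rw [hv₀, smul_zero, add_zero] at h0
    have := ha q.1 h0 hq.1.2
    have h2 := hq.1.1
    simp [this] at h2
  filter_upwards [h1] with b hb v hv hℓv
  refine hrN ?_
  by_contra hvr
  rw [Metric.mem_ball, not_lt, dist_eq_norm] at hvr
  have hpos : 0 < ‖v - v₀‖ := hr.trans_le hvr
  refine hb (‖v - v₀‖⁻¹ • (v - v₀), ‖v - v₀‖⁻¹) ⟨⟨?_, ?_⟩, ?_, ?_⟩ ?_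
  · simp [norm_smul, hpos.ne']
  · simp [hℓv]
  · exact inv_nonneg.mpr hpos.le
  · exact inv_anti₀ hr hvr
  · simp [hv]

end linearSystems

/-- In finite dimension an injective derivative is bounded below by `K⁻¹`; strict differentiability
makes the error at most half of this bound, so distinct nearby points have distinct images. -/
theorem eventually_injective_of_hasStrictFDerivAt {E F : Type*} [NormedAddCommGroup E]
    [NormedSpace ℝ E] [FiniteDimensional ℝ E] [NormedAddCommGroup F] [NormedSpace ℝ F]
    {Ψ : E → F} {Ψ' : E →L[ℝ] F} {p : E} (hΨ : HasStrictFDerivAt Ψ Ψ' p)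
    (hinj : ∀ v, Ψ' v = 0 → v = 0) :
    ∀ᶠ q : E × E in 𝓝 (p, p), Ψ q.1 = Ψ q.2 → q.1 = q.2 := by
  obtain ⟨K, hK, hKa⟩ := LinearMap.exists_antilipschitzWith (Ψ' : E →ₗ[ℝ] F)
    (LinearMap.ker_eq_bot'.mpr hinj)
  have hlow : ∀ v, ‖v‖ ≤ K * ‖Ψ' v‖ := fun v => by
    simpa using hKa.le_mul_dist v 0
  have hKpos : (0 : ℝ) < (K : ℝ)⁻¹ / 2 := by positivity
  filter_upwards [hΨ.isLittleO.def hKpos] with q hq heq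
  rw [heq, sub_self, zero_sub, norm_neg] at hq
  have h1 := hlow (q.1 - q.2)
  have h2 : ‖q.1 - q.2‖ ≤ ‖q.1 - q.2‖ / 2 := by
    calc ‖q.1 - q.2‖ ≤ K * ‖Ψ' (q.1 - q.2)‖ := h1
      _ ≤ K * ((K : ℝ)⁻¹ / 2 * ‖q.1 - q.2‖) := by gcongr
      _ = ‖q.1 - q.2‖ / 2 := by
        have : (K : ℝ) ≠ 0 := by positivity
        field_simp
  have h3 : ‖q.1 - q.2‖ = 0 := by linarith [norm_nonneg (q.1 - q.2)]
  exact sub_eq_zero.mp (norm_eq_zero.mp h3)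

/-! ### The local argument at a diagonal critical point -/

section core
variable {U : Type*} [NormedAddCommGroup U] [NormedSpace ℝ U]
  {F : U × U → Vec3 → ℝ} {u₀ : U} {X₀ : Vec3} {k : U → ℝ}

theorem contDiffAt_partial (hF : ContDiffAt ℝ ∞ (Function.uncurry F) ((u₀, u₀), X₀)) :
    ContDiffAt ℝ ∞ (fun w => F w X₀) (u₀, u₀) :=
  hF.comp (u₀, u₀) (g := Function.uncurry F) (f := fun w => (w, X₀)) (by fun_prop)

/-- If a function of two parameters vanishes on the diagonal, so does its second derivative. -/
theorem fderiv_fderiv_diag_eq_zero {G : U × U → ℝ} (hG : ContDiffAt ℝ 2 G (u₀, u₀))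
    (h0 : ∀ᶠ u in 𝓝 u₀, G (u, u) = 0) (e e' : U) :
    fderiv ℝ (fderiv ℝ G) (u₀, u₀) (e, e) (e', e') = 0 := by
  have hdiag : ∀ u : U, HasFDerivAt (fun u : U => (u, u))
      ((ContinuousLinearMap.id ℝ U).prod (ContinuousLinearMap.id ℝ U)) u := fun u =>
    (hasFDerivAt_id u).prodMk (hasFDerivAt_id u)
  have htend : Tendsto (fun u : U => (u, u)) (𝓝 u₀) (𝓝 (u₀, u₀)) :=
    Continuous.tendsto (by fun_prop) u₀
  have h1 : ∀ᶠ u in 𝓝 u₀, fderiv ℝ G (u, u) (e', e') = 0 := by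
    filter_upwards [h0.eventually_nhds, htend.eventually (hG.eventually (by simp))] with u hu hGu
    have h2 := HasFDerivAt.comp (f := fun u : U => (u, u)) u
      (hGu.differentiableAt (by simp)).hasFDerivAt (hdiag u)
    have h3 : HasFDerivAt (G ∘ fun u : U => (u, u)) (0 : U →L[ℝ] ℝ) u :=
      (hasFDerivAt_const (0 : ℝ) u).congr_of_eventuallyEq hu
    simpa using congrArg (fun L : U →L[ℝ] ℝ => L e') (h2.unique h3)
  have hd : DifferentiableAt ℝ (fderiv ℝ G) (u₀, u₀) :=
    (hG.fderiv_right (m := 1) (by norm_num)).differentiableAt (by simp)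
  have h4 : HasFDerivAt (fun u : U => fderiv ℝ G (u, u))
      ((fderiv ℝ (fderiv ℝ G) (u₀, u₀)).comp
        ((ContinuousLinearMap.id ℝ U).prod (ContinuousLinearMap.id ℝ U))) u₀ :=
    HasFDerivAt.comp (f := fun u : U => (u, u)) u₀ hd.hasFDerivAt (hdiag u₀)
  have h5 := h4.clm_apply (hasFDerivAt_const (e', e') u₀)
  have h6 : HasFDerivAt (fun u : U => fderiv ℝ G (u, u) (e', e')) (0 : U →L[ℝ] ℝ) u₀ :=
    (hasFDerivAt_const (0 : ℝ) u₀).congr_of_eventuallyEq h1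
  simpa using congrArg (fun L : U →L[ℝ] ℝ => L e) (h5.unique h6)

/-- For a function vanishing on the diagonal, non-degeneracy of the Hessian yields
non-degeneracy of its off-diagonal block. -/
theorem offDiag_nondegenerate [FiniteDimensional ℝ U] {G : U × U → ℝ} (hG : ContDiffAt ℝ 2 G (u₀, u₀))
    (h0 : ∀ᶠ u in 𝓝 u₀, G (u, u) = 0)
    (hinj : Function.Injective (fderiv ℝ (fderiv ℝ G) (u₀, u₀))) (d : U)
    (hd : ∀ e, fderiv ℝ (fderiv ℝ G) (u₀, u₀) (0, d) (e, e) = 0) : d = 0 := by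
  have hsymm : IsSymmSndFDerivAt ℝ G (u₀, u₀) := hG.isSymmSndFDerivAt (by simp)
  set T := fderiv ℝ (fderiv ℝ G) (u₀, u₀) with hT
  -- If `B e = 0`, then `T (e, e)` kills the vectors `(0, v)`, and it kills the diagonal ones
  -- because the function vanishes on the diagonal; these span, so `e = 0`. An injective map to the
  -- dual is onto, and `d` is then annihilated by every functional.
  let B : U →ₗ[ℝ] Module.Dual ℝ U :=
    { toFun := fun e => ((T (e, e)).comp (ContinuousLinearMap.inr ℝ U U)).toLinearMap
      map_add' := fun e e' => by
        ext v
        change T ((e, e) + (e', e')) (0, v) = _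
        rw [map_add]
        rfl
      map_smul' := fun c e => by
        ext v
        change T (c • (e, e)) (0, v) = _
        rw [map_smul]
        rfl }
  have hB : ∀ e v, B e v = T (e, e) (0, v) := fun e v => rfl
  have hBinj : Function.Injective B := by
    rw [injective_iff_map_eq_zero]
    intro e he
    have h1 : T (e, e) = 0 := by
      refine ContinuousLinearMap.ext fun v => ?_
      have hv : v = (v.1, v.1) + (0, v.2 - v.1) := by ext <;> simp
      rw [hv, map_add, fderiv_fderiv_diag_eq_zero hG h0, ← hB, he]
      simp
    have h2 : (e, e) = (0 : U × U) := hinj (by rw [h1, map_zero])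
    exact (Prod.mk_eq_zero.mp h2).1
  have hBsurj : Function.Surjective B :=
    (LinearMap.injective_iff_surjective_of_finrank_eq_finrank Subspace.dual_finrank_eq.symm).mp
      hBinj
  rw [← Module.forall_dual_apply_eq_zero_iff ℝ d]
  intro ℓ
  obtain ⟨e, rfl⟩ := hBsurj ℓ
  rw [hB, ← hd e]
  exact hsymm _ _

/-- A family of functions of two parameters that is `k u * Y 2` at `(u, u)` has, near a critical
point on the diagonal with non-degenerate off-diagonal Hessian block, critical points with
vanishing critical value only for `Y` in the plane `Y 2 = 0`. -/
theorem eventually_critical_mem_plane [FiniteDimensional ℝ U]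
    (hF : ContDiffAt ℝ ∞ (Function.uncurry F) ((u₀, u₀), X₀))
    (hdiag : ∀ᶠ u in 𝓝 u₀, ∀ Y, F (u, u) Y = k u * Y 2) (hk : k u₀ ≠ 0)
    (hF0 : F (u₀, u₀) X₀ = 0) (hdF0 : fderiv ℝ (fun w => F w X₀) (u₀, u₀) = 0)
    (hB : ∀ d : U, (∀ e, fderiv ℝ (fderiv ℝ (fun w => F w X₀)) (u₀, u₀) (0, d) (e, e) = 0) →
      d = 0) :
    ∀ᶠ q : (U × U) × Vec3 in 𝓝 ((u₀, u₀), X₀),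
      F q.1 q.2 = 0 → fderiv ℝ (fun w => F w q.2) q.1 = 0 → q.2 2 = 0 := by
  have hX₀ : X₀ 2 = 0 := by
    rw [hdiag.self_of_nhds, mul_eq_zero, or_iff_right hk] at hF0
    exact hF0
  let diagL : U →L[ℝ] U × U :=
    (ContinuousLinearMap.id ℝ U).prod (ContinuousLinearMap.id ℝ U)
  -- The derivative of `F` along the diagonal directions `(e, e)`.
  let G : (U × U) × Vec3 → U →L[ℝ] ℝ := fun q => (fderiv ℝ (fun w => F w q.2) q.1).comp diagL
  have hDF : ContDiffAt ℝ 1 (fun q : (U × U) × Vec3 => fderiv ℝ (fun w => F w q.2) q.1)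
      ((u₀, u₀), X₀) := by
    refine ContDiffAt.fderiv (f := fun (q : (U × U) × Vec3) (w : U × U) => F w q.2)
      (g := fun q => q.1) (n := 2) ?_ (by fun_prop) (by norm_num)
    exact ((hF.of_le (m := 2) (by norm_cast)).comp (((u₀, u₀), X₀), (u₀, u₀))
      (g := Function.uncurry F) (f := fun z : ((U × U) × Vec3) × (U × U) => (z.2, z.1.2))
      (by fun_prop))
  have hG : HasStrictFDerivAt G (fderiv ℝ G ((u₀, u₀), X₀)) ((u₀, u₀), X₀) :=
    (hDF.clm_comp contDiffAt_const).hasStrictFDerivAt (by simp)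
  have hFs : HasStrictFDerivAt (Function.uncurry F)
      (fderiv ℝ (Function.uncurry F) ((u₀, u₀), X₀)) ((u₀, u₀), X₀) :=
    hF.hasStrictFDerivAt (by simp)
  have hw : HasFDerivAt (fun w : U × U => (w, X₀)) (ContinuousLinearMap.inl ℝ (U × U) Vec3)
      (u₀, u₀) := (hasFDerivAt_id _).prodMk (hasFDerivAt_const _ _)
  have hY : HasFDerivAt (fun Y : Vec3 => ((u₀, u₀), Y)) (ContinuousLinearMap.inr ℝ (U × U) Vec3)
      X₀ := (hasFDerivAt_const _ _).prodMk (hasFDerivAt_id _)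
  have hFw : ∀ v, fderiv ℝ (Function.uncurry F) ((u₀, u₀), X₀) (v, 0) = 0 := fun v => by
    have h1 := HasFDerivAt.comp (f := fun w : U × U => (w, X₀)) (u₀, u₀) hFs.hasFDerivAt hw
    have h2 : fderiv ℝ (fun w => F w X₀) (u₀, u₀) = _ := h1.fderiv
    rw [hdF0] at h2
    exact (congrArg (fun L : U × U →L[ℝ] ℝ => L v) h2).symm
  have hFY : ∀ v : Vec3, fderiv ℝ (Function.uncurry F) ((u₀, u₀), X₀) (0, v) = k u₀ * v 2 :=
    fun v => by
    have h1 := HasFDerivAt.comp (f := fun Y : Vec3 => ((u₀, u₀), Y)) X₀ hFs.hasFDerivAt hY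
    have h2 : HasFDerivAt (fun Y : Vec3 => k u₀ * Y 2)
        (k u₀ • (ContinuousLinearMap.proj 2 : Vec3 →L[ℝ] ℝ)) X₀ :=
      (hasFDerivAt_apply 2 X₀).const_mul (k u₀)
    have h3 : (Function.uncurry F ∘ fun Y : Vec3 => ((u₀, u₀), Y)) = fun Y => k u₀ * Y 2 :=
      funext fun Y => hdiag.self_of_nhds Y
    rw [h3] at h1
    exact congrArg (fun L : Vec3 →L[ℝ] ℝ => L v) (h1.unique h2)
  have hGw : ∀ v e, fderiv ℝ G ((u₀, u₀), X₀) (v, 0) e =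
      fderiv ℝ (fderiv ℝ (fun w => F w X₀)) (u₀, u₀) v (e, e) := fun v e => by
    have h1 := HasFDerivAt.comp (f := fun w : U × U => (w, X₀)) (u₀, u₀) hG.hasFDerivAt hw
    have h2 : DifferentiableAt ℝ (fderiv ℝ (fun w => F w X₀)) (u₀, u₀) :=
      ((contDiffAt_partial hF).fderiv_right (m := 1) (by norm_cast)).differentiableAt
        (by simp)
    have h3 := h2.hasFDerivAt.clm_comp (hasFDerivAt_const diagL (u₀, u₀))
    have h4 := congrArg (fun L : U × U →L[ℝ] U →L[ℝ] ℝ => L v e) (h1.unique h3)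
    simpa [diagL] using h4
  let pl : Vec3 →L[ℝ] ℝ × ℝ :=
    (ContinuousLinearMap.proj 0).prod (ContinuousLinearMap.proj 1)
  -- In the kernel of the derivative the first components give `d₁ = 0` and `v 0 = v 1 = 0`. The
  -- `F`-component is then `k u₀ * v 2`, as `F` is critical in the pair, and the `G`-component is
  -- the off-diagonal block at `d₂`.
  have hΨ : HasStrictFDerivAt (fun q : (U × U) × Vec3 => (q.1.1, pl q.2, F q.1 q.2, G q)) _
      ((u₀, u₀), X₀) :=
    ((ContinuousLinearMap.fst ℝ U U).comp
      (ContinuousLinearMap.fst ℝ (U × U) Vec3)).hasStrictFDerivAt.prodMk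
      ((pl.comp (ContinuousLinearMap.snd ℝ (U × U) Vec3)).hasStrictFDerivAt.prodMk
        (hFs.prodMk hG))
  have hinj := eventually_injective_of_hasStrictFDerivAt hΨ (by
    rintro ⟨⟨d₁, d₂⟩, v⟩ hv
    have hv1 : d₁ = 0 := congrArg (fun z => z.1) hv
    have hv2 : v 0 = 0 := congrArg (fun z => z.2.1.1) hv
    have hv3 : v 1 = 0 := congrArg (fun z => z.2.1.2) hv
    have hv4 : fderiv ℝ (Function.uncurry F) ((u₀, u₀), X₀) ((d₁, d₂), v) = 0 :=
      congrArg (fun z => z.2.2.1) hv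
    have hv5 : fderiv ℝ G ((u₀, u₀), X₀) ((d₁, d₂), v) = 0 := congrArg (fun z => z.2.2.2) hv
    subst hv1
    have hsplit : (((0 : U), d₂), v) = (((0 : U), d₂), (0 : Vec3)) + ((0 : U × U), v) := by
      simp
    rw [hsplit, map_add, hFw, hFY, zero_add, mul_eq_zero, or_iff_right hk] at hv4
    have hv : v = 0 := by
      ext i
      fin_cases i
      exacts [hv2, hv3, hv4]
    subst hv
    have hd : d₂ = 0 := hB d₂ fun e => by
      rw [← hGw, hv5]
      rfl
    rw [hd]
    rfl)
  have hcont : Continuous fun q : (U × U) × Vec3 =>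
      (((q.1.1, q.1.1), ![q.2 0, q.2 1, 0]) : (U × U) × Vec3) := by
    have hc : ∀ i, Continuous fun q : (U × U) × Vec3 => q.2 i := fun i =>
      (continuous_apply i).comp continuous_snd
    refine Continuous.prodMk (by fun_prop) (continuous_pi fun i => ?_)
    fin_cases i
    · exact hc 0
    · exact hc 1
    · exact continuous_const
  have hX₀' : ![X₀ 0, X₀ 1, 0] = X₀ := by
    ext i
    fin_cases i
    exacts [rfl, rfl, hX₀.symm]
  have htend := (continuous_id.prodMk hcont).tendsto ((u₀, u₀), X₀)
  simp only [id, hX₀'] at htend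
  have hdiag' : ∀ᶠ q : (U × U) × Vec3 in 𝓝 ((u₀, u₀), X₀),
      ∀ᶠ u in 𝓝 q.1.1, ∀ Y, F (u, u) Y = k u * Y 2 :=
    (Continuous.tendsto (f := fun q : (U × U) × Vec3 => q.1.1) (by fun_prop)
      ((u₀, u₀), X₀)).eventually hdiag.eventually_nhds
  have hdiff : ∀ᶠ q : (U × U) × Vec3 in 𝓝 ((u₀, u₀), X₀),
      ContDiffAt ℝ 1 (Function.uncurry F) q :=
    (hF.of_le (by norm_cast)).eventually (by simp)
  filter_upwards [htend.eventually hinj, hdiag', (hcont.tendsto _).eventually (by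
    simpa only [hX₀'] using hdiff)] with q hq hqd hqF h0 h1
  set u := q.1.1 with hu
  set Y : Vec3 := ![q.2 0, q.2 1, 0] with hYdef
  have hFu : F (u, u) Y = 0 := by rw [hqd.self_of_nhds]; simp [hYdef]
  have hGu : G ((u, u), Y) = 0 := by
    have h2 : DifferentiableAt ℝ (fun w => F w Y) (u, u) :=
      DifferentiableAt.comp (g := Function.uncurry F) (f := fun w => (w, Y)) (u, u)
        (hqF.differentiableAt (by simp)) (by fun_prop)
    have h3 := HasFDerivAt.comp (f := fun v : U => (v, v)) u h2.hasFDerivAt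
      ((hasFDerivAt_id u).prodMk (hasFDerivAt_id u))
    refine h3.unique ((hasFDerivAt_const (0 : ℝ) u).congr_of_eventuallyEq ?_)
    filter_upwards [hqd] with v hv
    simp [hv, hYdef]
  have hGq : G q = 0 := by simp only [G, h1, ContinuousLinearMap.zero_comp]
  -- The triples `q` and `((u, u), Y)` share `u`, the horizontal coordinates and the vanishing of
  -- `F` and `G`; on the diagonal these vanish because `Y 2 = 0`.
  have key := hq (by
    rw [hGu, hGq, h0, hFu]
    rfl)
  have := congrArg (fun q => q.2 2) key
  simpa [hYdef] using this

end core

/-! ### Scaling the profile -/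

section profile
variable {I : Set ℝ} {f : ℝ → ℝ} {lam t : ℝ}

theorem ConvexProfile.contDiffAt (hp : ConvexProfile I f lam) (ht : t ∈ I) : ContDiffAt ℝ ∞ f t :=
  hp.smooth.contDiffAt (hp.isOpen.mem_nhds ht)

theorem deriv_const_mul_fun (lam : ℝ) (f : ℝ → ℝ) :
    deriv (fun t => lam * f t) = fun t => lam * deriv f t :=
  funext fun _ => deriv_const_mul_field lam

theorem ConvexProfile.scaled (hp : ConvexProfile I f lam) (hlam : lam ≠ 0) :
    ConvexProfile I (fun t => lam * f t) 1 where
  isOpen := hp.isOpen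
  nonempty := hp.nonempty
  ordConnected := hp.ordConnected
  smooth := contDiffOn_const.mul hp.smooth
  pos₁ := hp.pos₁
  pos₂ t ht := by simpa using hp.pos₂ t ht
  ne_zero t ht := mul_ne_zero hlam (hp.ne_zero t ht)
  convex t ht := by
    rw [deriv_const_mul_fun, deriv_const_mul_field]
    have := mul_pos (pow_pos (abs_pos.mpr hlam) 2) (hp.convex t ht)
    rw [sq_abs] at this
    linarith

theorem ConvexProfile.deriv_ne_zero (hp : ConvexProfile I f lam) (ht : t ∈ I) :
    deriv f t ≠ 0 := left_ne_zero_of_mul (hp.convex t ht).ne'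

theorem ConvexProfile.deriv_deriv_ne_zero (hp : ConvexProfile I f lam) (ht : t ∈ I) :
    deriv (deriv f) t ≠ 0 := right_ne_zero_of_mul (hp.convex t ht).ne'

end profile

theorem redFun_diag (h : ℝ → ℝ) (u : ℝ × ℝ) (X : Vec3) :
    redFun h (u, u) X = h u.1 * (2 - deriv h u.1) ^ 2 * X 2 := by
  simp only [redFun, redP, redQ, redL₁, redL₂, sub_self, cos_zero]
  ring

/-! ### Transversality of the tangent planes -/

section transversality

theorem tangentSpace_rotCurve_le_ker_iff {ρ ζ : ℝ → ℝ} {u : ℝ × ℝ} {ρ' ζ' : ℝ}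
    (hρ : HasDerivAt ρ ρ' u.1) (hζ : HasDerivAt ζ ζ' u.1) (ℓ : Module.Dual ℝ Vec3) :
    tangentSpace (rotCurve ρ ζ) u ≤ LinearMap.ker ℓ ↔
      ℓ ![ρ' * cos u.2, ρ' * sin u.2, ζ'] = 0 ∧
        ℓ ![-(ρ u.1 * sin u.2), ρ u.1 * cos u.2, 0] = 0 := by
  rw [← fderiv_rotCurve_fst hρ hζ, ← fderiv_rotCurve_snd hρ hζ, tangentSpace]
  constructor
  · intro hle
    exact ⟨hle ⟨(1, 0), rfl⟩, hle ⟨(0, 1), rfl⟩⟩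
  · rintro ⟨h1, h2⟩ _ ⟨d, rfl⟩
    have hd : d = d.1 • ((1 : ℝ), (0 : ℝ)) + d.2 • ((0 : ℝ), (1 : ℝ)) := by ext <;> simp
    rw [LinearMap.mem_ker, hd]
    simp only [ContinuousLinearMap.coe_coe, map_add, map_smul, h1, h2, smul_zero, add_zero]

theorem transversal_iff {φ₁ φ₂ : ℝ × ℝ → Vec3} {w : (ℝ × ℝ) × (ℝ × ℝ)} :
    Transversal φ₁ φ₂ w ↔ ∀ ℓ : Module.Dual ℝ Vec3, tangentSpace φ₁ w.1 ≤ LinearMap.ker ℓ →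
      tangentSpace φ₂ w.2 ≤ LinearMap.ker ℓ → ℓ = 0 := by
  constructor
  · intro ht ℓ h1 h2
    have h3 := sup_le h1 h2
    rw [Transversal] at ht
    rw [ht, top_le_iff, LinearMap.ker_eq_top] at h3
    exact h3
  · intro hℓ
    by_contra ht
    obtain ⟨ℓ, hℓ0, hle⟩ := Submodule.exists_le_ker_of_lt_top _ (lt_top_iff_ne_top.mpr ht)
    exact hℓ0 (hℓ ℓ (le_sup_left.trans hle) (le_sup_right.trans hle))

/-- The linear functional with given coefficients. -/
def functional (a b c : ℝ) : Module.Dual ℝ Vec3 :=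
  a • LinearMap.proj 0 + b • LinearMap.proj 1 + c • LinearMap.proj 2

theorem functional_apply (a b c : ℝ) (X : Vec3) :
    functional a b c X = a * X 0 + b * X 1 + c * X 2 := rfl

theorem exists_eq_functional (ℓ : Module.Dual ℝ Vec3) : ∃ a b c, ℓ = functional a b c := by
  refine ⟨ℓ (Pi.single 0 1), ℓ (Pi.single 1 1), ℓ (Pi.single 2 1), ?_⟩
  ext i
  fin_cases i <;> simp [functional_apply]

variable {f : ℝ → ℝ} {lam : ℝ}

theorem tangentSpace_rotSurface₁_le_ker_iff {s : ℝ} (α : ℝ) (h : DifferentiableAt ℝ f s)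
    (a b c : ℝ) : tangentSpace (rotSurface₁ f) (s, α) ≤ LinearMap.ker (functional a b c) ↔
      a * cos α + b * sin α + c * deriv f s = 0 ∧ s * (b * cos α - a * sin α) = 0 := by
  refine (tangentSpace_rotCurve_le_ker_iff (u := (s, α)) (hasDerivAt_id' s) h.hasDerivAt _).trans ?_
  simp only [functional_apply]
  refine and_congr ?_ ?_
  · simp
  · rw [iff_iff_eq]
    congr 1
    simp
    ring

theorem tangentSpace_rotSurface₂_le_ker_iff {t : ℝ} (β : ℝ) (h : DifferentiableAt ℝ f t)
    (a b c : ℝ) : tangentSpace (rotSurface₂ f lam) (t, β) ≤ LinearMap.ker (functional a b c) ↔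
      (1 - lam * deriv f t) * (a * cos β + b * sin β) - c * deriv f t = 0 ∧
        (t - lam * f t) * (b * cos β - a * sin β) = 0 := by
  refine (tangentSpace_rotCurve_le_ker_iff (u := (t, β))
    ((hasDerivAt_id' t).sub (h.hasDerivAt.const_mul lam)) h.hasDerivAt.neg _).trans ?_
  simp only [functional_apply]
  refine and_congr ?_ ?_ <;>
  · rw [iff_iff_eq]
    congr 1
    simp
    ring

/-- The two profile slopes are `f'` and `-f' / (1 - lam * f')`; they agree when `lam * f' = 2`, and
then the tangent planes at corresponding points are parallel. -/
theorem two_sub_ne_zero_of_transversal {t θ : ℝ} (h : DifferentiableAt ℝ f t)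
    (ht : Transversal (rotSurface₁ f) (rotSurface₂ f lam) ((t, θ), (t, θ))) :
    2 - lam * deriv f t ≠ 0 := by
  intro h0
  have h1 := transversal_iff.mp ht (functional (-(deriv f t * cos θ)) (-(deriv f t * sin θ)) 1)
    ((tangentSpace_rotSurface₁_le_ker_iff θ h _ _ _).mpr
      ⟨by linear_combination (-deriv f t) * sin_sq_add_cos_sq θ, by ring⟩)
    ((tangentSpace_rotSurface₂_le_ker_iff θ h _ _ _).mpr
      ⟨by linear_combination (-(1 - lam * deriv f t) * deriv f t) * sin_sq_add_cos_sq θ -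
        deriv f t * h0, by ring⟩)
  have h2 := congrArg (fun ℓ : Module.Dual ℝ Vec3 => ℓ ![0, 0, 1]) h1
  simp [functional_apply] at h2

/-- A non-zero functional vanishing on both tangent planes must have `c ≠ 0` and a horizontal part
along both radial directions, so the angles agree or differ by `π`. The conditions `hadd` and `hsub`
exclude these two cases. -/
theorem transversal_of_slopes {s t α β : ℝ} (hs : DifferentiableAt ℝ f s)
    (ht : DifferentiableAt ℝ f t) (hs0 : s ≠ 0) (ht0 : t - lam * f t ≠ 0)
    (h1 : deriv f s ≠ 0)
    (hadd : (1 - lam * deriv f t) * deriv f s + deriv f t ≠ 0)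
    (hsub : (1 - lam * deriv f t) * deriv f s - deriv f t ≠ 0) :
    Transversal (rotSurface₁ f) (rotSurface₂ f lam) ((s, α), (t, β)) := by
  rw [transversal_iff]
  intro ℓ
  obtain ⟨a, b, c, rfl⟩ := exists_eq_functional ℓ
  intro k1 k2
  obtain ⟨k1, k3⟩ := (tangentSpace_rotSurface₁_le_ker_iff α hs a b c).mp k1
  obtain ⟨k2, k4⟩ := (tangentSpace_rotSurface₂_le_ker_iff β ht a b c).mp k2
  rw [mul_eq_zero, or_iff_right hs0] at k3
  rw [mul_eq_zero, or_iff_right ht0] at k4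
  have hα := sin_sq_add_cos_sq α
  have hβ := sin_sq_add_cos_sq β
  set r := a * cos α + b * sin α with hr
  have ha : a = r * cos α := by rw [hr]; linear_combination (-a) * hα - sin α * k3
  have hb : b = r * sin α := by rw [hr]; linear_combination (-b) * hα + cos α * k3
  have hc : c = 0 := by
    by_contra hc
    have hr0 : r ≠ 0 := fun hr0 => by
      rw [hr0, zero_add, mul_eq_zero, or_iff_left h1] at k1
      exact hc k1
    have hS : sin α * cos β - cos α * sin β = 0 := by
      refine (mul_eq_zero.mp (?_ : r * _ = 0)).resolve_left hr0
      linear_combination k4 - cos β * hb + sin β * ha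
    set C := cos α * cos β + sin α * sin β with hC
    have hC2 : (C - 1) * (C + 1) = 0 := by
      have : C ^ 2 + (sin α * cos β - cos α * sin β) ^ 2 = 1 := by
        rw [hC]; linear_combination (sin β ^ 2 + cos β ^ 2) * hα + hβ
      rw [hS] at this
      linarith
    have k5 : (1 - lam * deriv f t) * (r * C) - c * deriv f t = 0 := by
      rw [hC]
      linear_combination k2 - (1 - lam * deriv f t) * (cos β * ha + sin β * hb)
    rcases mul_eq_zero.mp hC2 with h | h
    · refine hadd ((mul_eq_zero.mp (?_ : c * _ = 0)).resolve_left hc)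
      linear_combination (1 - lam * deriv f t) * k1 - k5 + (1 - lam * deriv f t) * r * h
    · refine hsub ((mul_eq_zero.mp (?_ : c * _ = 0)).resolve_left hc)
      linear_combination (1 - lam * deriv f t) * k1 + k5 - (1 - lam * deriv f t) * r * h
  have hr0 : r = 0 := by rw [hc, zero_mul, add_zero] at k1; exact k1
  rw [ha, hb, hc, hr0]
  simp [functional]

end transversality

/-! ### Corresponding points: the mid-plane and the local envelope -/

theorem midPlane_diag {I : Set ℝ} {f : ℝ → ℝ} {lam : ℝ} (hlam : lam ≠ 0)
    (hp : ConvexProfile I f lam) {u : ℝ × ℝ} (hu : u ∈ rotDomain I)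
    (ht : Transversal (rotSurface₁ f) (rotSurface₂ f lam) (u, u)) :
    midPlane (rotSurface₁ f) (rotSurface₂ f lam) (u, u) = {X | X 2 = 0} := by
  have hd := (hp.contDiffAt hu.1).differentiableAt (by simp)
  have h2 := two_sub_ne_zero_of_transversal hd ht
  have h1 := (hp.pos₁ _ hu.1).ne'
  have h3 := (hp.pos₂ _ hu.1).ne'
  have h4 := hp.ne_zero _ hu.1
  ext X
  rw [midPlane, Set.mem_ofPred_eq, Set.mem_ofPred_eq, midPlaneFun_rotSurface hlam hd hd, redFun_diag]
  simp [scaleThird, hlam, h1, h2, h3, h4]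

/-- At a pair of corresponding points, a generated point can only exist if the discriminant of the
linear system is non-zero. -/
theorem discriminant_ne_zero {h : ℝ → ℝ} {t : ℝ} (h0 : h t ≠ 0)
    (h2 : deriv (deriv h) t ≠ 0) (h3 : 2 - deriv h t ≠ 0) {v : ℝ × ℝ × ℝ × ℝ}
    (hv : critForm h (t, t, 0) v = 0) (hv1 : v.2.2.2 = 1) :
    deriv h t ^ 2 * (2 - deriv h t) + 2 * h t * deriv (deriv h) t ≠ 0 := by
  obtain ⟨a, b, z, m⟩ := v
  dsimp only at hv1
  subst hv1
  simp only [critForm, redP, redQ, LinearMap.coe_mk, AddHom.coe_mk, sub_zero, cos_zero, sin_zero,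
    Prod.mk_eq_zero] at hv
  obtain ⟨e1, e2, -⟩ := hv
  generalize h t = p at *
  generalize deriv (deriv h) t = r at *
  generalize deriv h t = q at *
  have hz : z = 0 := by
    have : p * (2 - q) ^ 2 * z = 0 := by linear_combination e1
    simpa [h0, h3] using this
  subst hz
  -- With `p`, `q`, `r` for `h`, `h'`, `h''`: if the coefficient of `a - t` vanishes, the second
  -- equation leaves `p * (q * (2 - q) + p * r) = 0`; combined with `hD` this gives `p * r * (2 - q)
  -- = 0`.
  intro hD
  have e3 : p * (q * (2 - q) + p * r) = 0 := by
    linear_combination -e2 - (a - t) * hD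
  rw [mul_eq_zero, or_iff_right h0] at e3
  have e4 : p * r * (2 - q) = 0 := by
    linear_combination hD - q * e3
  simp [h0, h2, h3] at e4

/-- At equal parameters and angles the homogeneous system is triangular: the value gives `z`, the
first curve parameter `a` with the discriminant as coefficient, the first angle `b`. Hence a
generated point over the diagonal is unique and none lies at infinity. -/
theorem critForm_diag_ker {h : ℝ → ℝ} {t : ℝ} (h0 : h t ≠ 0) (h1 : deriv h t ≠ 0)
    (h3 : 2 - deriv h t ≠ 0)
    (hD : deriv h t ^ 2 * (2 - deriv h t) + 2 * h t * deriv (deriv h) t ≠ 0)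
    (v : ℝ × ℝ × ℝ × ℝ) (hv : critForm h (t, t, 0) v = 0) (hv1 : v.2.2.2 = 0) : v = 0 := by
  obtain ⟨a, b, z, m⟩ := v
  dsimp only at hv1
  subst hv1
  simp only [critForm, redP, redQ, LinearMap.coe_mk, AddHom.coe_mk, sub_zero, cos_zero, sin_zero,
    Prod.mk_eq_zero] at hv
  obtain ⟨e1, e2, -, e4, -⟩ := hv
  generalize h t = p at *
  generalize deriv (deriv h) t = r at *
  generalize deriv h t = q at *
  have hz : z = 0 := by
    have : p * (2 - q) ^ 2 * z = 0 := by linear_combination e1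
    simpa [h0, h3] using this
  subst hz
  have ha : a = 0 := by
    refine (mul_eq_zero.mp (?_ : a * _ = 0)).resolve_right hD
    linear_combination -e2
  have hb : b = 0 := by
    have : p * (2 - q) * q * b = 0 := by linear_combination -e4
    simpa [h0, h3, h1] using this
  rw [ha, hb]
  rfl

/-- The point with given coordinates in the frame rotated by the angle `α`. -/
def ofFrame (α : ℝ) (v : ℝ × ℝ × ℝ × ℝ) : Vec3 :=
  ![v.1 * cos α - v.2.1 * sin α, v.1 * sin α + v.2.1 * cos α, v.2.2.1]

theorem ofFrame_frameCoord (α : ℝ) (X : Vec3) : ofFrame α (frameCoord α X) = X := by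
  ext i
  fin_cases i
  · simp [ofFrame, frameCoord]
    linear_combination X 0 * sin_sq_add_cos_sq α
  · simp [ofFrame, frameCoord]
    linear_combination X 1 * sin_sq_add_cos_sq α
  · simp [ofFrame, frameCoord]

theorem continuous_ofFrame : Continuous fun q : ℝ × (ℝ × ℝ × ℝ × ℝ) => ofFrame q.1 q.2 := by
  refine continuous_pi fun i => ?_
  fin_cases i <;> simp only [ofFrame] <;> simp <;> fun_prop

/-- `eventually_ker_mem_nhds` with the homogenising coordinate as `ℓ`, carried back from the rotated
frame. It confines generated points to the neighbourhood on which the local argument applies. -/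
theorem eventually_generated_mem_nhds {h : ℝ → ℝ} {t : ℝ} (hh : ContDiffAt ℝ ∞ h t)
    (hker : ∀ v, critForm h (t, t, 0) v = 0 → v.2.2.2 = 0 → v = 0) (θ : ℝ) {X₀ : Vec3}
    (hX₀ : critForm h (t, t, 0) (frameCoord θ X₀) = 0) {N : Set Vec3} (hN : N ∈ 𝓝 X₀) :
    ∀ᶠ w in 𝓝 ((t, θ), (t, θ)), ∀ X,
      critForm h (w.1.1, w.2.1, w.1.2 - w.2.2) (frameCoord w.1.2 X) = 0 → X ∈ N := by
  have h1 : ∀ᶠ q : ℝ × (ℝ × ℝ × ℝ × ℝ) in 𝓝 (θ, frameCoord θ X₀), ofFrame q.1 q.2 ∈ N := by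
    have := continuous_ofFrame.tendsto (θ, frameCoord θ X₀)
    simp only [ofFrame_frameCoord] at this
    exact this.eventually hN
  rw [nhds_prod_eq] at h1
  obtain ⟨A, hA, B, hB, hAB⟩ := eventually_prod_iff.mp h1
  have h2 := eventually_ker_mem_nhds (T := critForm h) (a := (t, t, 0))
    ((LinearMap.snd ℝ ℝ ℝ).comp ((LinearMap.snd ℝ ℝ (ℝ × ℝ)).comp
      (LinearMap.snd ℝ ℝ (ℝ × ℝ × ℝ)))) (continuousAt_critForm hh hh) hker hX₀ hB
  have c1 : Tendsto (fun w : (ℝ × ℝ) × (ℝ × ℝ) => (w.1.1, w.2.1, w.1.2 - w.2.2))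
      (𝓝 ((t, θ), (t, θ))) (𝓝 (t, t, 0)) := by
    have : Continuous (fun w : (ℝ × ℝ) × (ℝ × ℝ) => (w.1.1, w.2.1, w.1.2 - w.2.2)) := by fun_prop
    simpa using this.tendsto ((t, θ), (t, θ))
  have c2 : Tendsto (fun w : (ℝ × ℝ) × (ℝ × ℝ) => w.1.2) (𝓝 ((t, θ), (t, θ))) (𝓝 θ) :=
    Continuous.tendsto (f := fun w : (ℝ × ℝ) × (ℝ × ℝ) => w.1.2) (by fun_prop) ((t, θ), (t, θ))
  filter_upwards [c1.eventually h2, c2.eventually hA] with w hw1 hw2 X hX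
  have := hAB hw2 (hw1 _ hX rfl)
  simpa only [ofFrame_frameCoord] using this

theorem continuous_scaleThird (lam : ℝ) : Continuous (scaleThird lam) := by
  refine continuous_pi fun i => ?_
  fin_cases i <;> simp [scaleThird] <;> fun_prop

theorem contDiff_scaleThird (lam : ℝ) : ContDiff ℝ ∞ (scaleThird lam) := by
  rw [contDiff_pi]
  intro i
  fin_cases i <;> simp [scaleThird] <;> fun_prop

theorem scaleThird_scaleThird_inv {lam : ℝ} (hlam : lam ≠ 0) (X : Vec3) :
    scaleThird lam⁻¹ (scaleThird lam X) = X := by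
  ext i
  fin_cases i <;> simp [scaleThird, hlam]

theorem eventually_prod_generates {f : ℝ → ℝ} {lam : ℝ} (hlam : lam ≠ 0) {I : Set ℝ}
    (hp : ConvexProfile I f lam) {u : ℝ × ℝ} (hu : u ∈ rotDomain I) {X : Vec3}
    (hX : Generates (rotSurface₁ f) (rotSurface₂ f lam) (u, u) X)
    (hH : HessianNondegenerate (rotSurface₁ f) (rotSurface₂ f lam) (u, u) X) :
    ∀ᶠ w in 𝓝 (u, u), ∀ Y,
      Generates (rotSurface₁ f) (rotSurface₂ f lam) w Y → Y 2 = 0 := by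
  obtain ⟨t, θ⟩ := u
  have ht : t ∈ I := hu.1
  have hq := hp.scaled hlam
  have hsf := hp.contDiffAt ht
  have hsh := hq.contDiffAt ht
  set h : ℝ → ℝ := fun t => lam * f t with hh
  have hpos : t ≠ 0 := (hp.pos₁ _ ht).ne'
  have hpos' : t - lam * f t ≠ 0 := (hp.pos₂ _ ht).ne'
  have h2 : 2 - deriv h t ≠ 0 := by
    have := two_sub_ne_zero_of_transversal (hsf.differentiableAt (by simp)) hX.1
    rwa [hh, deriv_const_mul_field]
  have hcrit : ∀ {w : (ℝ × ℝ) × (ℝ × ℝ)} (Y : Vec3), w.1.1 ∈ I → w.2.1 ∈ I →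
      Generates (rotSurface₁ f) (rotSurface₂ f lam) w Y →
      critForm h (w.1.1, w.2.1, w.1.2 - w.2.2) (frameCoord w.1.2 (scaleThird lam Y)) = 0 := by
    intro w Y hw1 hw2 hY
    have h3 := (critical_midPlaneFun_iff hlam (hp.contDiffAt hw1) (hp.contDiffAt hw2)
      (hp.pos₁ _ hw1).ne' (hp.pos₂ _ hw2).ne' Y).mp hY.2
    exact (critical_redFun_iff (hq.contDiffAt hw1) (hq.contDiffAt hw2) _).mp h3
  have hX₀ : critForm h (t, t, 0) (frameCoord θ (scaleThird lam X)) = 0 := by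
    simpa using hcrit X ht ht hX
  -- Uniqueness of the generated point comes from its existence; the Hessian condition enters only
  -- through `hB` below.
  have hD := discriminant_ne_zero (hq.ne_zero t ht) (hq.deriv_deriv_ne_zero ht) h2 hX₀ rfl
  have hker := critForm_diag_ker (hq.ne_zero t ht) (hq.deriv_ne_zero ht) h2 hD
  have heq := eventually_midPlaneFun_eq hlam (w := ((t, θ), (t, θ))) hsf hsf
  have hF : ContDiffAt ℝ ∞ (Function.uncurry (midPlaneFun (rotSurface₁ f) (rotSurface₂ f lam)))
      (((t, θ), (t, θ)), X) := by
    have e1 : Function.uncurry (midPlaneFun (rotSurface₁ f) (rotSurface₂ f lam))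
        =ᶠ[𝓝 (((t, θ), (t, θ)), X)] fun q => redFactor f lam q.1 *
          Function.uncurry (redFun h) (q.1, scaleThird lam q.2) := by
      filter_upwards [continuous_fst.tendsto _ |>.eventually heq] with q hq'
      exact hq' q.2
    refine ContDiffAt.congr_of_eventuallyEq (ContDiffAt.mul ?_ ?_) e1
    · exact (contDiffAt_redFactor lam hsf).comp (((t, θ), (t, θ)), X)
        (g := redFactor f lam) (f := Prod.fst) contDiffAt_fst
    · exact (contDiffAt_uncurry_redFun (w := ((t, θ), (t, θ))) hsh hsh (scaleThird lam X)).comp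
        (((t, θ), (t, θ)), X) (g := Function.uncurry (redFun h))
        (f := fun q : ((ℝ × ℝ) × (ℝ × ℝ)) × Vec3 => (q.1, scaleThird lam q.2))
        (contDiffAt_fst.prodMk ((contDiff_scaleThird lam).contDiffAt.comp _ contDiffAt_snd))
  have hdiag : ∀ᶠ u in 𝓝 (t, θ), ∀ Y, midPlaneFun (rotSurface₁ f) (rotSurface₂ f lam) (u, u) Y =
      redFactor f lam (u, u) * (h u.1 * (2 - deriv h u.1) ^ 2 * lam) * Y 2 := by
    have c : Tendsto (fun u : ℝ × ℝ => (u, u)) (𝓝 (t, θ)) (𝓝 ((t, θ), (t, θ))) :=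
      Continuous.tendsto (by fun_prop) _
    filter_upwards [c.eventually heq] with u hu Y
    rw [hu Y, redFun_diag]
    simp only [scaleThird, Matrix.cons_val]
    ring
  have hk : redFactor f lam ((t, θ), (t, θ)) * (h t * (2 - deriv h t) ^ 2 * lam) ≠ 0 := by
    have := hq.ne_zero t ht
    unfold redFactor
    positivity
  have hG : ContDiffAt ℝ 2
      (fun w => midPlaneFun (rotSurface₁ f) (rotSurface₂ f lam) w X) ((t, θ), (t, θ)) :=
    (contDiffAt_partial hF).of_le (by norm_cast)
  have hX2 : X 2 = 0 := by
    have h3 := hX.2.1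
    rwa [hdiag.self_of_nhds X, mul_eq_zero, or_iff_right hk] at h3
  have hB := offDiag_nondegenerate hG
    (hdiag.mono fun u hu => by rw [hu X, hX2, mul_zero]) hH
  have hcore := eventually_critical_mem_plane
    (k := fun u => redFactor f lam (u, u) * (h u.1 * (2 - deriv h u.1) ^ 2 * lam))
    hF hdiag hk hX.2.1 hX.2.2 hB
  rw [nhds_prod_eq] at hcore
  obtain ⟨A, hA, B, hB', hAB⟩ := eventually_prod_iff.mp hcore
  have hN : {Z | B (scaleThird lam⁻¹ Z)} ∈ 𝓝 (scaleThird lam X) := by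
    have := (continuous_scaleThird lam⁻¹).tendsto (scaleThird lam X)
    rw [scaleThird_scaleThird_inv hlam] at this
    exact this.eventually hB'
  have hI1 : ∀ᶠ w : (ℝ × ℝ) × (ℝ × ℝ) in 𝓝 ((t, θ), (t, θ)), w.1.1 ∈ I :=
    (Continuous.tendsto (f := fun w : (ℝ × ℝ) × (ℝ × ℝ) => w.1.1) (by fun_prop)
      ((t, θ), (t, θ))).eventually (hp.isOpen.mem_nhds ht)
  have hI2 : ∀ᶠ w : (ℝ × ℝ) × (ℝ × ℝ) in 𝓝 ((t, θ), (t, θ)), w.2.1 ∈ I :=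
    (Continuous.tendsto (f := fun w : (ℝ × ℝ) × (ℝ × ℝ) => w.2.1) (by fun_prop)
      ((t, θ), (t, θ))).eventually (hp.isOpen.mem_nhds ht)
  filter_upwards [hA, hI1, hI2, eventually_generated_mem_nhds hsh hker θ hX₀ hN]
    with w hwA hw1 hw2 hwN Y hY
  have h4 := hwN _ (hcrit Y hw1 hw2 hY)
  simp only [scaleThird_scaleThird_inv hlam] at h4
  exact hAB hwA h4 hY.2.1 hY.2.2

theorem exists_nhds_EMH_subset {f : ℝ → ℝ} {lam : ℝ} (hlam : lam ≠ 0) {I : Set ℝ}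
    (hp : ConvexProfile I f lam) {u : ℝ × ℝ} (hu : u ∈ rotDomain I) {X : Vec3}
    (hX : Generates (rotSurface₁ f) (rotSurface₂ f lam) (u, u) X)
    (hH : HessianNondegenerate (rotSurface₁ f) (rotSurface₂ f lam) (u, u) X) :
    ∃ V : Set (ℝ × ℝ), IsOpen V ∧ u ∈ V ∧ V ⊆ rotDomain I ∧
      EMH (rotSurface₁ f) (rotSurface₂ f lam) V V ⊆ {Y | Y 2 = 0} := by
  obtain ⟨V₁, V₂, hV₁, hu₁, hV₂, hu₂, hV⟩ :=
    mem_nhds_prod_iff'.mp (eventually_prod_generates hlam hp hu hX hH)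
  refine ⟨V₁ ∩ V₂ ∩ rotDomain I, (hV₁.inter hV₂).inter (hp.isOpen.prod isOpen_univ),
    ⟨⟨hu₁, hu₂⟩, hu⟩, Set.inter_subset_right, ?_⟩
  rintro Y ⟨u₁, hu₁', u₂, hu₂', hY⟩
  exact hV ⟨hu₁'.1.1, hu₂'.1.2⟩ Y hY

/-! ### Rigidity of the profile curve -/

section profileFunctions
variable {I : Set ℝ} {f : ℝ → ℝ} {lam : ℝ}

theorem ConvexProfile.hasDerivAt (hp : ConvexProfile I f lam) {t : ℝ} (ht : t ∈ I) :
    HasDerivAt f (deriv f t) t :=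
  ((hp.contDiffAt ht).differentiableAt (by simp)).hasDerivAt

theorem ConvexProfile.injOn (hp : ConvexProfile I f lam) : Set.InjOn f I := by
  have key : ∀ a ∈ I, ∀ b ∈ I, a < b → f a ≠ f b := fun a ha b hb hab heq => by
    have hsub : Set.Icc a b ⊆ I := hp.ordConnected.out ha hb
    obtain ⟨c, hc, hc0⟩ := exists_deriv_eq_zero hab (hp.smooth.continuousOn.mono hsub) heq
    exact hp.deriv_ne_zero (hsub (Set.Ioo_subset_Icc_self hc)) hc0
  intro a ha b hb heq
  rcases lt_trichotomy a b with h | h | h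
  · exact absurd heq (key a ha b hb h)
  · exact h
  · exact absurd heq.symm (key b hb a ha h)

/-- A continuous function without zeros on an interval has constant sign. -/
theorem ConvexProfile.mul_pos (hp : ConvexProfile I f lam) {s t : ℝ} (hs : s ∈ I) (ht : t ∈ I) :
    0 < f s * f t := by
  by_contra hneg
  have hc : IsPreconnected I := hp.ordConnected.isPreconnected
  have h0 : (0 : ℝ) ∈ f '' I := by
    rcases le_total (f s) 0 with h | h
    · refine hc.intermediate_value hs ht hp.smooth.continuousOn ⟨h, ?_⟩
      by_contra h'
      have := hp.ne_zero s hs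
      exact hneg (mul_pos_of_neg_of_neg (lt_of_le_of_ne h this) (not_le.mp h'))
    · refine hc.intermediate_value ht hs hp.smooth.continuousOn ⟨?_, h⟩
      by_contra h'
      have := hp.ne_zero s hs
      exact hneg (_root_.mul_pos (lt_of_le_of_ne h this.symm) (not_le.mp h'))
  obtain ⟨t, ht, h0⟩ := h0
  exact hp.ne_zero t ht h0

theorem ConvexProfile.const_of_hasDerivAt_zero (hp : ConvexProfile I f lam) {F : ℝ → ℝ}
    (hF : ∀ t ∈ I, HasDerivAt F 0 t) : ∃ c, ∀ t ∈ I, F t = c := by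
  obtain ⟨a, ha⟩ := hp.nonempty
  refine ⟨F a, fun t ht => ?_⟩
  exact hp.isOpen.is_const_of_deriv_eq_zero hp.ordConnected.isPreconnected
    (fun x hx => (hF x hx).differentiableAt.differentiableWithinAt)
    (fun x hx => (hF x hx).deriv) ht ha

/-- The profile function is not affine. -/
theorem ConvexProfile.not_affine (hp : ConvexProfile I f lam) {a b : ℝ}
    (h : ∀ t ∈ I, t = a * f t + b) : False := by
  obtain ⟨t, ht⟩ := hp.nonempty
  have h1 : ∀ t ∈ I, a * deriv f t = 1 := fun t ht => by
    have h2 : HasDerivAt (fun r => a * f r + b) (a * deriv f t) t :=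
      ((hp.hasDerivAt ht).const_mul a).add_const b
    refine h2.unique ((hasDerivAt_id' t).congr_of_eventuallyEq ?_)
    filter_upwards [hp.isOpen.mem_nhds ht] with r hr
    exact (h r hr).symm
  have ha : a ≠ 0 := 
    left_ne_zero_of_mul (b := deriv f t) (by rw [h1 t ht]; exact one_ne_zero)
  have h3 : deriv f =ᶠ[𝓝 t] fun _ => 1 / a := by
    filter_upwards [hp.isOpen.mem_nhds ht] with r hr
    rw [eq_div_iff ha, mul_comm, h1 r hr]
  refine hp.deriv_deriv_ne_zero ht ?_
  rw [h3.deriv_eq, deriv_const]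

/-- The only affine fields in the plane of the profile satisfying the tangency conditions along
both profile curves are trivial. -/
theorem ConvexProfile.eq_zero_of_tangent (hp : ConvexProfile I f lam) (hlam : lam ≠ 0) {w v b : ℝ}
    (h1 : ∀ t ∈ I, t * w = deriv f t * (f t * v + b))
    (h2 : ∀ t ∈ I, (t - lam * f t) * (1 - lam * deriv f t) * w = deriv f t * (f t * v - b)) :
    w = 0 ∧ v = 0 ∧ b = 0 := by
  have hw : w = 0 := by
    by_contra hw
    -- Twice `h1` is the derivative of `t ^ 2 * w - f ^ 2 * v - 2 * b * f`.
    obtain ⟨c, hc⟩ := hp.const_of_hasDerivAt_zero 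
      (F := fun t => t * t * w - f t * f t * v - 2 * b * f t)
      fun t ht => by
        have hf := hp.hasDerivAt ht
        have hi := hasDerivAt_id' t
        refine ((((hi.mul hi).mul_const w).sub ((hf.mul hf).mul_const v)).sub
          (hf.const_mul (2 * b))).congr_deriv ?_
        linear_combination 2 * h1 t ht
    -- In `h1 - h2` the terms in `v` cancel; after division by `lam * w` the difference integrates
    -- to this second conserved quantity.
    obtain ⟨c', hc'⟩ := hp.const_of_hasDerivAt_zero
      (F := fun t => t * f t - lam / 2 * (f t * f t) - 2 * b / (lam * w) * f t)
      fun t ht => by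
        have hf := hp.hasDerivAt ht
        have hi := hasDerivAt_id' t
        refine (((hi.mul hf).sub ((hf.mul hf).const_mul (lam / 2))).sub
          (hf.const_mul (2 * b / (lam * w)))).congr_deriv ?_
        field_simp
        linear_combination 2 * h1 t ht - 2 * h2 t ht
    have hinf : (f '' I).Infinite := by
      refine Set.Infinite.image hp.injOn ?_
      exact infinite_of_mem_nhds hp.nonempty.some (hp.isOpen.mem_nhds hp.nonempty.some_mem)
    -- Eliminating `t` from the two first integrals gives a polynomial relation for `y = f t`, valid
    -- for infinitely many `y`. Its constant term forces `c' = 0`, and dividing the second integral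
    -- by `f t` makes `t` affine in `f t`.
    let p : Polynomial ℝ := .C w * (.C (lam / 2) * .X ^ 2 + .C (2 * b / (lam * w)) * .X + .C c') ^ 2
      - .X ^ 2 * (.C v * .X ^ 2 + .C (2 * b) * .X + .C c)
    have hp0 : p = 0 := by
      refine Polynomial.eq_zero_of_infinite_isRoot p (hinf.mono ?_)
      rintro _ ⟨t, ht, rfl⟩
      have e1 : t * f t = lam / 2 * f t ^ 2 + 2 * b / (lam * w) * f t + c' := by
        linear_combination hc' t ht
      have e2 : t ^ 2 * w = v * f t ^ 2 + 2 * b * f t + c := by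
        linear_combination hc t ht
      simp only [Set.mem_ofPred_eq, Polynomial.IsRoot.def, p, Polynomial.eval_sub,
        Polynomial.eval_mul, Polynomial.eval_add, Polynomial.eval_pow, Polynomial.eval_C,
        Polynomial.eval_X]
      rw [← e1, ← e2]
      ring
    have hc0 : c' = 0 := by
      have := congrArg (Polynomial.eval 0) hp0
      simpa [p, hw] using this
    refine hp.not_affine (a := lam / 2) (b := 2 * b / (lam * w)) fun t ht => ?_
    refine mul_right_cancel₀ (hp.ne_zero t ht) ?_
    linear_combination hc' t ht + hc0
  subst hw
  have h3 : ∀ t ∈ I, f t * v + b = 0 := fun t ht =>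
    (mul_eq_zero.mp ((h1 t ht).symm.trans (mul_zero t))).resolve_left (hp.deriv_ne_zero ht)
  obtain ⟨t, ht⟩ := hp.nonempty
  have hv : v = 0 := by
    have h4 : HasDerivAt (fun r => f r * v + b) (deriv f t * v) t :=
      ((hp.hasDerivAt ht).mul_const v).add_const b
    have h5 : deriv f t * v = 0 := by
      refine h4.unique ((hasDerivAt_const t (0 : ℝ)).congr_of_eventuallyEq ?_)
      filter_upwards [hp.isOpen.mem_nhds ht] with r hr
      exact h3 r hr
    exact (mul_eq_zero.mp h5).resolve_left (hp.deriv_ne_zero ht)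
  refine ⟨rfl, hv, ?_⟩
  simpa [hv] using h3 t ht

end profileFunctions

/-! ### Rotations about the axis and tangency -/

section rotation

/-- The rotation by the angle `τ` about the `z`-axis. -/
def rotZ (τ : ℝ) (X : Vec3) : Vec3 :=
  ![X 0 * cos τ - X 1 * sin τ, X 0 * sin τ + X 1 * cos τ, X 2]

/-- The generator of the rotations about the `z`-axis. -/
def rotGen : Vec3 →ₗ[ℝ] Vec3 where
  toFun X := ![-X 1, X 0, 0]
  map_add' X Y := by ext i; fin_cases i <;> simp; ring
  map_smul' c X := by ext i; fin_cases i <;> simp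

theorem rotGen_apply (X : Vec3) : rotGen X = ![-X 1, X 0, 0] := rfl

theorem hasDerivAt_rotZ (X : Vec3) : HasDerivAt (fun τ => rotZ τ X) (rotGen X) 0 := by
  rw [hasDerivAt_pi]
  intro i
  fin_cases i
  · exact (((hasDerivAt_cos 0).const_mul (X 0)).sub
      ((hasDerivAt_sin 0).const_mul (X 1))).congr_deriv (by simp [rotGen])
  · exact (((hasDerivAt_sin 0).const_mul (X 0)).add
      ((hasDerivAt_cos 0).const_mul (X 1))).congr_deriv (by simp [rotGen])
  · simpa [rotZ, rotGen] using hasDerivAt_const (0 : ℝ) (X 2)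

theorem rotZ_zero (X : Vec3) : rotZ 0 X = X := by
  ext i
  fin_cases i <;> simp [rotZ]

theorem rotZ_rotCurve (ρ ζ : ℝ → ℝ) (τ : ℝ) (u : ℝ × ℝ) :
    rotZ τ (rotCurve ρ ζ u) = rotCurve ρ ζ (u.1, u.2 + τ) := by
  ext i
  fin_cases i
  · simp [rotZ, rotCurve, cos_add]; ring
  · simp [rotZ, rotCurve, sin_add]; ring
  · simp [rotZ, rotCurve]

theorem rotZ_mem {ρ ζ : ℝ → ℝ} {I : Set ℝ} (τ : ℝ) {X : Vec3}
    (hX : X ∈ rotCurve ρ ζ '' rotDomain I) : rotZ τ X ∈ rotCurve ρ ζ '' rotDomain I := by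
  obtain ⟨u, hu, rfl⟩ := hX
  exact ⟨(u.1, u.2 + τ), ⟨hu.1, trivial⟩, (rotZ_rotCurve ρ ζ τ u).symm⟩

theorem norm_horizontal_rotCurve {ρ ζ : ℝ → ℝ} {u : ℝ × ℝ} (h : 0 ≤ ρ u.1) :
    √(rotCurve ρ ζ u 0 ^ 2 + rotCurve ρ ζ u 1 ^ 2) = ρ u.1 := by
  have : rotCurve ρ ζ u 0 ^ 2 + rotCurve ρ ζ u 1 ^ 2 = ρ u.1 ^ 2 := by
    simp [rotCurve]
    linear_combination ρ u.1 ^ 2 * sin_sq_add_cos_sq u.2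
  rw [this, Real.sqrt_sq h]

end rotation

/-- The tangency condition for a curve in the surface of rotation of a curve that is the graph
`σ * z = f (x + μ * z)`. -/
theorem tangent_of_mem_rotCurve {ρ ζ f : ℝ → ℝ} {I : Set ℝ} {σ μ : ℝ} {c : ℝ → Vec3} {V : Vec3}
    (hc : HasDerivAt c V 0) (hmem : ∀ τ, c τ ∈ rotCurve ρ ζ '' rotDomain I)
    (hρ : ∀ t ∈ I, 0 < ρ t) (hρt : ∀ t ∈ I, ρ t + μ * ζ t = t) (hζ : ∀ t ∈ I, σ * ζ t = f t)
    {u : ℝ × ℝ} (hu : u ∈ rotDomain I) (hcu : c 0 = rotCurve ρ ζ u)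
    (hf : DifferentiableAt ℝ f u.1) :
    σ * V 2 = deriv f u.1 * (V 0 * cos u.2 + V 1 * sin u.2 + μ * V 2) := by
  have hc0 := hasDerivAt_pi.mp hc
  have hr := hρ u.1 hu.1
  have hn := norm_horizontal_rotCurve (ζ := ζ) hr.le
  have hsq : c 0 0 ^ 2 + c 0 1 ^ 2 ≠ 0 := by
    intro h0
    rw [← hcu, h0, Real.sqrt_zero] at hn
    exact hr.ne hn
  have hd : HasDerivAt (fun τ => √(c τ 0 ^ 2 + c τ 1 ^ 2) + μ * c τ 2)
      ((2 * c 0 0 * V 0 + 2 * c 0 1 * V 1) / (2 * √(c 0 0 ^ 2 + c 0 1 ^ 2)) + μ * V 2) 0 := by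
    refine ((((hc0 0).pow 2).add ((hc0 1).pow 2)).sqrt hsq |>.add ((hc0 2).const_mul μ)).congr_deriv
      ?_
    simp
  have hval : √(c 0 0 ^ 2 + c 0 1 ^ 2) + μ * c 0 2 = u.1 := by
    rw [hcu, hn]
    exact hρt u.1 hu.1
  have hcomp := HasDerivAt.comp (h₂ := f) (0 : ℝ) (by rw [hval]; exact hf.hasDerivAt) hd
  -- The surface satisfies `f (√(x ^ 2 + y ^ 2) + μ * z) = σ * z`; differentiating this along the
  -- curve gives the claim.
  have heq : (f ∘ fun τ => √(c τ 0 ^ 2 + c τ 1 ^ 2) + μ * c τ 2) = fun τ => σ * c τ 2 := by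
    funext τ
    obtain ⟨v, hv, hvc⟩ := hmem τ
    simp only [Function.comp_apply, ← hvc]
    rw [norm_horizontal_rotCurve (hρ _ hv.1).le]
    change f (ρ v.1 + μ * ζ v.1) = σ * ζ v.1
    rw [hρt _ hv.1, hζ _ hv.1]
  rw [heq] at hcomp
  have key := ((hc0 2).const_mul σ).unique hcomp
  rw [key, hcu, hn]
  congr 2
  simp only [rotCurve, Matrix.cons_val]
  field_simp

/-! ### Non-existence of an affine reflection -/

section reflection
variable {I : Set ℝ} {f : ℝ → ℝ} {lam : ℝ} {R : Vec3 →ᵃ[ℝ] Vec3}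

theorem linear_linear_of_involutive (hR : ∀ x, R (R x) = x) (v : Vec3) :
    R.linear (R.linear v) = v := by
  have h1 : R (v + R 0) = R.linear v + R (R 0) := by
    simpa using R.map_vadd (R 0) v
  have h2 : R v = R.linear v + R 0 := by simpa using R.map_vadd 0 v
  have h3 : R (R v) = R.linear (R.linear v) + R (R 0) := by
    rw [h2]; simpa using R.map_vadd (R 0) (R.linear v)
  rw [hR, hR] at h3
  simpa using h3.symm

/-- The infinitesimal generator of the conjugates under `R` of the rotations about the `z`-axis. -/
def conjGen (R : Vec3 →ᵃ[ℝ] Vec3) (X : Vec3) : Vec3 := R.linear (rotGen (R X))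

theorem hasDerivAt_conj_rotZ (R : Vec3 →ᵃ[ℝ] Vec3) (X : Vec3) :
    HasDerivAt (fun τ => R (rotZ τ (R X))) (conjGen R X) 0 := by
  have h1 : ∀ Y, R Y = R.linear Y + R 0 := fun Y => by simpa using R.map_vadd 0 Y
  have h2 : HasDerivAt (fun τ => LinearMap.toContinuousLinearMap R.linear (rotZ τ (R X)))
      (LinearMap.toContinuousLinearMap R.linear (rotGen (R X))) 0 :=
    (LinearMap.toContinuousLinearMap R.linear).hasFDerivAt.comp_hasDerivAt 0
      (hasDerivAt_rotZ (R X))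
  have h3 := h2.add_const (R 0)
  refine h3.congr_of_eventuallyEq (Eventually.of_forall fun τ => ?_)
  exact h1 _

/-- The linear part of the affine field `conjGen R`. -/
def conjLin (R : Vec3 →ᵃ[ℝ] Vec3) : Vec3 →ₗ[ℝ] Vec3 := R.linear ∘ₗ rotGen ∘ₗ R.linear

theorem conjGen_eq (R : Vec3 →ᵃ[ℝ] Vec3) (X : Vec3) :
    conjGen R X = conjLin R X + conjGen R 0 := by
  have h1 : R X = R.linear X + R 0 := by simpa using R.map_vadd 0 X
  rw [conjGen, h1, map_add, map_add]
  rfl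

theorem apply_eq_sum (M : Vec3 →ₗ[ℝ] Vec3) (X : Vec3) (i : Fin 3) :
    M X i = X 0 * M (Pi.single 0 1) i + X 1 * M (Pi.single 1 1) i + X 2 * M (Pi.single 2 1) i := by
  have hX : X = X 0 • Pi.single 0 1 + X 1 • Pi.single 1 1 + X 2 • Pi.single 2 1 := by
    ext i
    fin_cases i <;> simp
  conv_lhs => rw [hX]
  simp only [map_add, map_smul, Pi.add_apply, Pi.smul_apply, smul_eq_mul]

theorem conjGen_apply (R : Vec3 →ᵃ[ℝ] Vec3) (X : Vec3) (i : Fin 3) :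
    conjGen R X i = X 0 * conjLin R (Pi.single 0 1) i + X 1 * conjLin R (Pi.single 1 1) i +
      X 2 * conjLin R (Pi.single 2 1) i + conjGen R 0 i := by
  rw [conjGen_eq, Pi.add_apply, apply_eq_sum]

/-- `conjLin R` is the conjugate by the involution `R.linear` of the rotation generator `J`, and `J
^ 3 = -J`. -/
theorem conjLin_cubed (hR : ∀ x, R (R x) = x) (X : Vec3) :
    conjLin R (conjLin R (conjLin R X)) = -conjLin R X := by
  have hL := linear_linear_of_involutive hR
  have hJ : ∀ Y, rotGen (rotGen (rotGen Y)) = -rotGen Y := fun Y => by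
    ext i
    fin_cases i <;> simp [rotGen_apply]
  simp only [conjLin, LinearMap.comp_apply, hL, hJ, map_neg]

variable (hR : ∀ x, R (R x) = x)
  (hS : R '' (rotSurface₁ f '' rotDomain I) = rotSurface₂ f lam '' rotDomain I)

include hR hS

theorem image_image_eq :
    R '' (rotSurface₂ f lam '' rotDomain I) = rotSurface₁ f '' rotDomain I := by
  rw [← hS, Set.image_image]
  simp [hR]

theorem conj_rotZ_mem₁ {X : Vec3} (hX : X ∈ rotSurface₁ f '' rotDomain I) (τ : ℝ) :
    R (rotZ τ (R X)) ∈ rotSurface₁ f '' rotDomain I := by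
  rw [← image_image_eq hR hS]
  refine Set.mem_image_of_mem R
    (rotZ_mem (ρ := fun t => t - lam * f t) (ζ := fun t => -f t) τ ?_)
  rw [← rotSurface₂_eq_rotCurve, ← hS]
  exact Set.mem_image_of_mem R hX

theorem conj_rotZ_mem₂ {X : Vec3} (hX : X ∈ rotSurface₂ f lam '' rotDomain I) (τ : ℝ) :
    R (rotZ τ (R X)) ∈ rotSurface₂ f lam '' rotDomain I := by
  rw [← hS]
  refine Set.mem_image_of_mem R (rotZ_mem (ρ := fun t => t) (ζ := f) τ ?_)
  rw [← rotSurface₁_eq_rotCurve, ← image_image_eq hR hS]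
  exact Set.mem_image_of_mem R hX

theorem conjGen_tangent₁ (hp : ConvexProfile I f lam) {u : ℝ × ℝ} (hu : u ∈ rotDomain I) :
    conjGen R (rotSurface₁ f u) 2 = deriv f u.1 *
      (conjGen R (rotSurface₁ f u) 0 * cos u.2 + conjGen R (rotSurface₁ f u) 1 * sin u.2) := by
  have h := tangent_of_mem_rotCurve (ρ := fun t => t) (ζ := f) (f := f) (σ := 1) (μ := 0)
    (hasDerivAt_conj_rotZ R (rotSurface₁ f u))
    (conj_rotZ_mem₁ hR hS (Set.mem_image_of_mem _ hu)) hp.pos₁ (by simp) (by simp) hu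
    (by rw [rotZ_zero, hR, rotSurface₁_eq_rotCurve]) (hp.hasDerivAt hu.1).differentiableAt
  simpa using h

theorem conjGen_tangent₂ (hp : ConvexProfile I f lam) {u : ℝ × ℝ} (hu : u ∈ rotDomain I) :
    -conjGen R (rotSurface₂ f lam u) 2 = deriv f u.1 *
      (conjGen R (rotSurface₂ f lam u) 0 * cos u.2 + conjGen R (rotSurface₂ f lam u) 1 * sin u.2 -
        lam * conjGen R (rotSurface₂ f lam u) 2) := by
  have h := tangent_of_mem_rotCurve (ρ := fun t => t - lam * f t) (ζ := fun t => -f t) (f := f)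
    (σ := -1) (μ := -lam) (hasDerivAt_conj_rotZ R (rotSurface₂ f lam u))
    (conj_rotZ_mem₂ hR hS (Set.mem_image_of_mem _ hu)) hp.pos₂ (fun t _ => by ring)
    (fun t _ => by ring) hu
    (by rw [rotZ_zero, hR, rotSurface₂_eq_rotCurve]) (hp.hasDerivAt hu.1).differentiableAt
  linear_combination h

/-- Half the difference of the tangency conditions at opposite angles isolates the terms to which
`eq_zero_of_tangent` applies: angles `0` and `π` for the `xz`-plane, `±π / 2` for the `yz`-plane. -/
theorem conjLin_entries_eq_zero (hlam : lam ≠ 0) (hp : ConvexProfile I f lam) :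
    (conjLin R (Pi.single 0 1) 2 = 0 ∧ conjLin R (Pi.single 2 1) 0 = 0 ∧ conjGen R 0 0 = 0) ∧
      (conjLin R (Pi.single 1 1) 2 = 0 ∧ conjLin R (Pi.single 2 1) 1 = 0 ∧ conjGen R 0 1 = 0) := by
  have k1 := fun t (ht : t ∈ I) (θ : ℝ) =>
    conjGen_tangent₁ hR hS hp (u := (t, θ)) ⟨ht, trivial⟩
  have k2 := fun t (ht : t ∈ I) (θ : ℝ) =>
    conjGen_tangent₂ hR hS hp (u := (t, θ)) ⟨ht, trivial⟩
  simp only [conjGen_apply R (rotSurface₁ _ _)] at k1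
  simp only [conjGen_apply R (rotSurface₂ _ _ _)] at k2
  constructor
  · refine hp.eq_zero_of_tangent hlam (fun t ht => ?_) (fun t ht => ?_)
    · have e1 := k1 t ht 0
      have e2 := k1 t ht π
      simp [rotSurface₁] at e1 e2
      linear_combination (e1 - e2) / 2
    · have e1 := k2 t ht 0
      have e2 := k2 t ht π
      simp [rotSurface₂] at e1 e2
      linear_combination (e2 - e1) / 2
  · refine hp.eq_zero_of_tangent hlam (fun t ht => ?_) (fun t ht => ?_)
    · have e1 := k1 t ht (π / 2)
      have e2 := k1 t ht (-(π / 2))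
      simp [rotSurface₁] at e1 e2
      linear_combination (e1 - e2) / 2
    · have e1 := k2 t ht (π / 2)
      have e2 := k2 t ht (-(π / 2))
      simp [rotSurface₂] at e1 e2
      linear_combination (e2 - e1) / 2

/-- The linear part of an affine reflection exchanging the two surfaces preserves the direction of
the `z`-axis and the horizontal plane, and its translation part is vertical. -/
theorem linear_preserves_axis (hlam : lam ≠ 0) (hp : ConvexProfile I f lam) :
    (R.linear (Pi.single 2 1) 0 = 0 ∧ R.linear (Pi.single 2 1) 1 = 0) ∧
      (R.linear (Pi.single 0 1) 2 = 0 ∧ R.linear (Pi.single 1 1) 2 = 0) ∧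
      (R 0 0 = 0 ∧ R 0 1 = 0) := by
  have hL := linear_linear_of_involutive hR
  obtain ⟨⟨a1, a2, a3⟩, ⟨b1, b2, b3⟩⟩ := conjLin_entries_eq_zero hR hS hlam hp
  have hm : conjLin R (Pi.single 2 1) = 0 := by
    set m := conjLin R (Pi.single 2 1) 2 with hm
    have e1 : conjLin R (Pi.single 2 1) = m • Pi.single 2 1 := by
      ext i
      fin_cases i
      · simpa using a2
      · simpa using b2
      · simp [← hm]
    -- The axis is an eigendirection with eigenvalue `m`, so `m ^ 3 = -m`, whose only real solution
    -- is `0`.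
    have e2 := conjLin_cubed hR (Pi.single 2 1)
    simp only [e1, map_smul] at e2
    have e3 := congrFun e2 2
    simp at e3
    have e4 : m = 0 := by
      have : m * (m ^ 2 + 1) = 0 := by linear_combination e3
      have h5 : m ^ 2 + 1 ≠ 0 := by positivity
      simpa [h5] using this
    rw [e1, e4, zero_smul]
  have hrange : ∀ X, conjLin R X 2 = 0 := fun X => by
    rw [apply_eq_sum, a1, b1, hm]
    simp
  have hhor : ∀ Y, R.linear (rotGen Y) 2 = 0 := fun Y => by
    have := hrange (R.linear Y)
    simpa only [conjLin, LinearMap.comp_apply, hL] using this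
  have hker : ∀ Y, R.linear (rotGen Y) = 0 → Y 0 = 0 ∧ Y 1 = 0 := fun Y hY => by
    have h1 : rotGen Y = 0 := by rw [← hL (rotGen Y), hY, map_zero]
    rw [rotGen_apply] at h1
    have e1 := congrFun h1 0
    have e2 := congrFun h1 1
    simp at e1 e2
    exact ⟨e2, e1⟩
  refine ⟨hker _ hm, ⟨?_, ?_⟩, hker _ ?_⟩
  · have h1 : (Pi.single 0 1 : Vec3) = rotGen (-Pi.single 1 1) := by
      ext i
      fin_cases i <;> simp [rotGen_apply]
    rw [h1]
    exact hhor _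
  · have h1 : (Pi.single 1 1 : Vec3) = rotGen (Pi.single 0 1) := by
      ext i
      fin_cases i <;> simp [rotGen_apply]
    rw [h1]
    exact hhor _
  · ext i
    fin_cases i
    exacts [a3, b3, hhor _]

/-- `R` acts on heights by `ε * z + const` with `ε = ±1` and on the horizontal plane linearly. `ε =
1` contradicts the constant sign of `f`. For `ε = -1` heights are matched exactly, so a circle of
radius `t` goes to one of radius `t - lam * f t`, while an involutive planar similarity has ratio
`1`. -/
theorem no_affineReflection (hlam : lam ≠ 0) (hp : ConvexProfile I f lam) : False := by
  obtain ⟨⟨c0, c1⟩, ⟨d0, d1⟩, ⟨r0, r1⟩⟩ := linear_preserves_axis hR hS hlam hp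
  have hL := linear_linear_of_involutive hR
  set p := R.linear (Pi.single 0 1) 0 with hpdef
  set r := R.linear (Pi.single 0 1) 1 with hrdef
  set q := R.linear (Pi.single 1 1) 0 with hqdef
  set s := R.linear (Pi.single 1 1) 1 with hsdef
  set ε := R.linear (Pi.single 2 1) 2 with hεdef
  set z := R 0 2 with hzdef
  have hRX : ∀ X, R X = ![p * X 0 + q * X 1, r * X 0 + s * X 1, ε * X 2 + z] := fun X => by
    have h1 : R X = R.linear X + R 0 := by simpa using R.map_vadd 0 X
    rw [h1]
    ext i
    rw [Pi.add_apply, apply_eq_sum]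
    fin_cases i
    · simp [c0, r0, ← hpdef, ← hqdef]; ring
    · simp [c1, r1, ← hrdef, ← hsdef]; ring
    · simp [d0, d1, ← hεdef, ← hzdef]; ring
  have hinv := fun X => hR X
  simp only [hRX] at hinv
  have i1 := hinv ![0, 0, 0]
  have i2 := hinv ![0, 0, 1]
  have i3 := hinv ![1, 0, 0]
  have f1 := congrFun i1 2
  have f2 := congrFun i2 2
  have f3 := congrFun i3 0
  have f4 := congrFun i3 1
  simp at f1 f2 f3 f4
  have hinj := hp.injOn
  have hfwd : ∀ t ∈ I, ∃ t' ∈ I, -f t' = ε * f t + z ∧ ∀ θ,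
      (t' - lam * f t') ^ 2 = (p * (t * cos θ) + q * (t * sin θ)) ^ 2 +
        (r * (t * cos θ) + s * (t * sin θ)) ^ 2 := by
    intro t ht
    have key : ∀ θ, ∃ t' ∈ I, -f t' = ε * f t + z ∧
      (t' - lam * f t') ^ 2 = (p * (t * cos θ) + q * (t * sin θ)) ^ 2 +
        (r * (t * cos θ) + s * (t * sin θ)) ^ 2 := by
      intro θ
      have h1 : R (rotSurface₁ f (t, θ)) ∈ rotSurface₂ f lam '' rotDomain I := by
        rw [← hS]
        exact Set.mem_image_of_mem _ ⟨(t, θ), ⟨ht, trivial⟩, rfl⟩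
      obtain ⟨u, hu, hu'⟩ := h1
      rw [hRX] at hu'
      have g0 := congrFun hu' 0
      have g1 := congrFun hu' 1
      have g2 := congrFun hu' 2
      simp [rotSurface₁, rotSurface₂] at g0 g1 g2
      refine ⟨u.1, hu.1, g2, ?_⟩
      rw [← g0, ← g1]
      linear_combination (-(u.1 - lam * f u.1) ^ 2) * sin_sq_add_cos_sq u.2
    -- The image height does not depend on `θ`, so by injectivity of `f` neither does the image
    -- parameter.
    obtain ⟨t', ht', h1, -⟩ := key 0
    refine ⟨t', ht', h1, fun θ => ?_⟩
    obtain ⟨t₂, ht₂, h2, h3⟩ := key θ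
    have : t₂ = t' := hinj ht₂ ht' (by linarith)
    rw [← this, h3]
  have hbwd : ∀ t ∈ I, ∃ t' ∈ I, f t' = -ε * f t + z := by
    intro t ht
    have h1 : R (rotSurface₂ f lam (t, 0)) ∈ rotSurface₁ f '' rotDomain I := by
      rw [← image_image_eq hR hS]
      exact Set.mem_image_of_mem _ ⟨(t, 0), ⟨ht, trivial⟩, rfl⟩
    obtain ⟨u, hu, hu'⟩ := h1
    rw [hRX] at hu'
    have g2 := congrFun hu' 2
    simp [rotSurface₁, rotSurface₂] at g2
    exact ⟨u.1, hu.1, by linarith⟩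
  have hε : ε = 1 ∨ ε = -1 := by
    have : ε * ε = 1 := by linarith
    exact mul_self_eq_one_iff.mp this
  obtain ⟨t₀, ht₀⟩ := hp.nonempty
  rcases hε with hε | hε
  · have hz : z = 0 := by rw [hε] at f1; linarith
    obtain ⟨t', ht', h1, -⟩ := hfwd t₀ ht₀
    have h2 := hp.mul_pos ht₀ ht'
    have h3 : f t' = -f t₀ := by rw [hε, hz] at h1; linarith
    rw [h3] at h2
    nlinarith [sq_nonneg (f t₀)]
  · have hz : z = 0 := by
      -- Applying `R` to one surface raises the value of `f` by `z`, and to the other lowers it by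
      -- `z`. Iterating, `f` would attain `f t₀ + n * z` and `f t₀ - n * z`, of opposite signs for
      -- large `n`.
      by_contra hz
      have up : ∀ n : ℕ, ∃ t ∈ I, f t = f t₀ + n * z := by
        intro n
        induction n with
        | zero => exact ⟨t₀, ht₀, by simp⟩
        | succ n ih =>
          obtain ⟨t, ht, h1⟩ := ih
          obtain ⟨t', ht', h2⟩ := hbwd t ht
          exact ⟨t', ht', by rw [h2, h1, hε]; push_cast; ring⟩
      have down : ∀ n : ℕ, ∃ t ∈ I, f t = f t₀ - n * z := by
        intro n
        induction n with
        | zero => exact ⟨t₀, ht₀, by simp⟩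
        | succ n ih =>
          obtain ⟨t, ht, h1⟩ := ih
          obtain ⟨t', ht', h2, -⟩ := hfwd t ht
          refine ⟨t', ht', ?_⟩
          rw [hε] at h2
          push_cast
          linarith
      obtain ⟨n, hn⟩ := exists_nat_gt (|f t₀| / |z|)
      rw [div_lt_iff₀ (abs_pos.mpr hz)] at hn
      obtain ⟨t, ht, h1⟩ := up n
      obtain ⟨t', ht', h2⟩ := down n
      have h3 := hp.mul_pos ht ht'
      rw [h1, h2] at h3
      have h4 : f t₀ ^ 2 < (n * z) ^ 2 := by
        rw [sq_lt_sq, abs_mul, Nat.abs_cast]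
        exact hn
      nlinarith
    obtain ⟨t', ht', h1, h2⟩ := hfwd t₀ ht₀
    have h3 : t' = t₀ := hinj ht' ht₀ (by rw [hε, hz] at h1; linarith)
    rw [h3] at h2
    have ht0 := (hp.pos₁ t₀ ht₀)
    have e1 := h2 0
    have e2 := h2 (π / 2)
    have e3 := h2 (π / 4)
    simp only [cos_zero, sin_zero, cos_pi_div_two, sin_pi_div_two, cos_pi_div_four,
      sin_pi_div_four] at e1 e2 e3
    have hsq2 : (√2 / 2) ^ 2 = (1 / 2 : ℝ) := by
      rw [div_pow, Real.sq_sqrt (by norm_num)]; norm_num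
    have hfne := hp.ne_zero t₀ ht₀
    have hg := hp.pos₂ t₀ ht₀
    have k1 : p ^ 2 + r ^ 2 = q ^ 2 + s ^ 2 := by
      have : t₀ ^ 2 * (p ^ 2 + r ^ 2 - (q ^ 2 + s ^ 2)) = 0 := by linear_combination e2 - e1
      have h5 : t₀ ^ 2 ≠ 0 := by positivity
      simpa [h5, sub_eq_zero] using this
    have k2 : p * q + r * s = 0 := by
      have : t₀ ^ 2 * (p * q + r * s) = 0 := by
        linear_combination (e1 + e2) / 2 - e3 - t₀ ^ 2 * ((p + q) ^ 2 + (r + s) ^ 2) * hsq2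
      have h5 : t₀ ^ 2 ≠ 0 := by positivity
      simpa [h5] using this
    -- By `k1` and `k2` the horizontal block is a similarity of squared ratio `p ^ 2 + r ^ 2`; its
    -- square is the identity, so this squared ratio has square `1`.
    have k3 : (p ^ 2 + r ^ 2 - 1) * (p ^ 2 + r ^ 2 + 1) = 0 := by
      linear_combination (p * p + q * r + 1) * f3 + (r * p + s * r) * f4 - 2 * p * r * k2 +
        r ^ 2 * k1
    have k4 : p ^ 2 + r ^ 2 = 1 := by
      have h5 : p ^ 2 + r ^ 2 + 1 ≠ 0 := by positivity
      simpa [h5, sub_eq_zero] using k3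
    have k5 : (t₀ - lam * f t₀) ^ 2 = t₀ ^ 2 := by linear_combination e1 + t₀ ^ 2 * k4
    have k6 := (sq_eq_sq₀ hg.le ht0.le).mp k5
    exact mul_ne_zero hlam hfne (by linarith)

end reflection

/-! ### The global example: a quadratic profile -/

/-- For points of the plane `F` vanishes on the diagonal, so the two curve-parameter equations are
opposite; one linear equation with coefficient `D` remains. -/
theorem critForm_diag_solution {h : ℝ → ℝ} {t : ℝ}
    (hD : deriv h t ^ 2 * (2 - deriv h t) + 2 * h t * deriv (deriv h) t ≠ 0) :
    ∃ x, critForm h (t, t, 0) (x, 0, 0, 1) = 0 := by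
  set D := deriv h t ^ 2 * (2 - deriv h t) + 2 * h t * deriv (deriv h) t with hDdef
  obtain ⟨ξ, hξ⟩ : ∃ ξ, D * ξ = -(h t * (deriv h t * (2 - deriv h t) + h t * deriv (deriv h) t)) :=
    ⟨-(h t * (deriv h t * (2 - deriv h t) + h t * deriv (deriv h) t)) / D, by field_simp⟩
  refine ⟨t + ξ, ?_⟩
  rw [hDdef] at hξ
  simp only [critForm, redP, redQ, LinearMap.coe_mk, AddHom.coe_mk, sub_zero, cos_zero, sin_zero,
    Prod.mk_eq_zero]
  refine ⟨by ring, ?_, ?_, by ring, by ring⟩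
  · linear_combination -hξ
  · linear_combination hξ

theorem critForm_congr_angle (h : ℝ → ℝ) (s t : ℝ) {φ ψ : ℝ} (hc : cos φ = cos ψ)
    (hs : sin φ = sin ψ) : critForm h (s, t, φ) = critForm h (s, t, ψ) := by
  refine LinearMap.ext fun v => ?_
  simp only [critForm, redP, redQ, LinearMap.coe_mk, AddHom.coe_mk, sub_zero, hc, hs]

theorem frameCoord_ofFrame (α a b z : ℝ) : frameCoord α (ofFrame α (a, b, z, 1)) = (a, b, z, 1) := by
  simp only [frameCoord, ofFrame, Prod.mk.injEq]
  refine ⟨?_, ?_, ?_, trivial⟩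
  · simp
    linear_combination a * sin_sq_add_cos_sq α
  · simp
    linear_combination b * sin_sq_add_cos_sq α
  · simp

/-- A quadratic profile. -/
def quadProfile (t : ℝ) : ℝ := 1 / 2 + (t - 1) / 10 + 5 * (t - 1) ^ 2

theorem hasDerivAt_quadProfile (t : ℝ) : HasDerivAt quadProfile (1 / 10 + 10 * (t - 1)) t := by
  have h1 := (hasDerivAt_id' t).sub_const 1
  refine (((h1.div_const 10).const_add (1 / 2)).add ((h1.pow 2).const_mul 5)).congr_deriv ?_
  norm_num
  ring

theorem deriv_quadProfile : deriv quadProfile = fun t => 1 / 10 + 10 * (t - 1) :=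
  funext fun t => (hasDerivAt_quadProfile t).deriv

theorem deriv_deriv_quadProfile : deriv (deriv quadProfile) = fun _ => 10 := by
  rw [deriv_quadProfile]
  funext t
  have h1 := (((hasDerivAt_id' t).sub_const 1).const_mul 10).const_add (1 / 10)
  rw [h1.deriv]
  norm_num

theorem contDiff_quadProfile : ContDiff ℝ ∞ quadProfile := by
  unfold quadProfile
  fun_prop

/-- The terms `η` and `θ` are small. If `S = 0`, then `c = -1` and `hC` fails outright. Otherwise
`hA` keeps `c` between `-11 / 20` and `0`, so `S ^ 2 * ρ ≥ 2 / 3` is too large for the remaining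
terms of `hC`. -/
theorem quad_bounds {c S ρ σ η θ : ℝ} (hcs : S ^ 2 + c ^ 2 = 1) (hc : c ≠ 1) (hρ1 : 1 ≤ ρ)
    (hρ2 : ρ ≤ 17 / 15) (hσ1 : σ ≤ 1) (hσ2 : 15 / 17 ≤ σ) (hη : η = ρ * (c + 9 / 10) / 100)
    (hθ : θ = σ * (9 / 10 * c + 1) / 100)
    (hC : -(1 / 2 - c) * ((η + θ) / 10) + 9 / 10 * θ - c * η - S ^ 2 * ρ = 0)
    (hA : S ≠ 0 → -((η + θ) / 10) + η - σ / 2 - c * ρ = 0) : False := by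
  have hcl : -1 ≤ c := by nlinarith [sq_nonneg S]
  have hcu : c ≤ 1 := by nlinarith [sq_nonneg S]
  by_cases hS : S = 0
  · have hc1 : c = -1 := by
      have : (c - 1) * (c + 1) = 0 := by rw [hS] at hcs; linarith
      rcases mul_eq_zero.mp this with h | h
      · exact absurd (by linarith) hc
      · linarith
    rw [hS, hη, hθ, hc1] at hC
    linarith
  replace hA := hA hS
  have hη1 : |η| ≤ 1 / 40 := by
    rw [hη, abs_div, abs_mul, abs_of_pos (by linarith : 0 < ρ),
      abs_of_pos (by norm_num : (0 : ℝ) < 100)]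
    have h1 : |c + 9 / 10| ≤ 19 / 10 := abs_le.mpr ⟨by linarith, by linarith⟩
    have h2 : ρ * |c + 9 / 10| ≤ 17 / 15 * (19 / 10) := by gcongr
    linarith
  have hθ1 : |θ| ≤ 1 / 40 := by
    rw [hθ, abs_div, abs_mul, abs_of_pos (by linarith : 0 < σ),
      abs_of_pos (by norm_num : (0 : ℝ) < 100)]
    have h1 : |9 / 10 * c + 1| ≤ 19 / 10 := abs_le.mpr ⟨by linarith, by linarith⟩
    have h2 : σ * |9 / 10 * c + 1| ≤ 1 * (19 / 10) := by gcongr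
    linarith
  obtain ⟨hη2, hη3⟩ := abs_le.mp hη1
  obtain ⟨hθ2, hθ3⟩ := abs_le.mp hθ1
  have hc0 : c < 0 := by
    by_contra h
    have : 0 ≤ c * ρ := mul_nonneg (not_lt.mp h) (by linarith)
    linarith
  have hc2 : -(11 / 20) ≤ c := by
    have : c * (ρ - 1) ≤ 0 := mul_nonpos_of_nonpos_of_nonneg hc0.le (by linarith)
    linarith
  have hS2 : 2 / 3 ≤ S ^ 2 := by
    have : (c + 11 / 20) * (c - 11 / 20) ≤ 0 :=
      mul_nonpos_of_nonneg_of_nonpos (by linarith) (by linarith)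
    linarith
  have hS3 : 2 / 3 * 1 ≤ S ^ 2 * ρ := mul_le_mul hS2 hρ1 (by norm_num) (sq_nonneg S)
  have h1 : |(1 / 2 - c) * ((η + θ) / 10)| ≤ 2 * (1 / 200) := by
    rw [abs_mul]
    refine mul_le_mul (abs_le.mpr ⟨by linarith, by linarith⟩)
      (abs_le.mpr ⟨by linarith, by linarith⟩) (abs_nonneg _) (by norm_num)
  have h2 : |c * η| ≤ 1 * (1 / 40) := by
    rw [abs_mul]
    exact mul_le_mul (abs_le.mpr ⟨by linarith, by linarith⟩) hη1 (abs_nonneg _) (by norm_num)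
  obtain ⟨h3, -⟩ := abs_le.mp h1
  obtain ⟨h4, -⟩ := abs_le.mp h2
  linarith

/-- The linear system for the points generated by two points over the central parameter of the
quadratic profile whose angles differ has only the trivial solution. -/
theorem quad_system_trivial {c S a b z m P Q l₁ l₂ : ℝ} (hcs : S ^ 2 + c ^ 2 = 1) (hc : c ≠ 1)
    (hP : P = 9 / 10 + c / 20) (hQ : Q = 17 / 20 + c / 10)
    (hl₁ : l₁ = -(1 / 10) * (a - m) + z - 1 / 2 * m)
    (hl₂ : l₂ = 1 / 10 * (c * a - S * b - 1 / 2 * m) + 9 / 10 * (z + 1 / 2 * m))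
    (e0 : Q * l₁ + P * l₂ = 0)
    (e1 : (c / 10 + 9 / 100) * l₁ - Q * (10 * (a - m)) - 10 * (1 - c / 2) * l₂ = 0)
    (e2 : 10 * (c - 3 / 2) * l₁ + (9 / 100 * c + 1 / 10) * l₂ +
      P * (10 * (c * a - S * b - 1 / 2 * m - (z + 1 / 2 * m))) = 0)
    (e3 : S * (l₁ / 10 + l₂ / 20) + Q * b / 10 = 0)
    (e4 : S * (l₁ / 10 + l₂ / 20) + P * (S * a + c * b) / 10 = 0) :
    a = 0 ∧ b = 0 ∧ z = 0 ∧ m = 0 := by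
  have hcl : -1 ≤ c := by nlinarith [sq_nonneg S]
  have hcu : c ≤ 1 := by nlinarith [sq_nonneg S]
  have hP0 : 0 < P := by linarith
  have hQ0 : 0 < Q := by linarith
  -- The first equation says that `(l₁, l₂)` is a multiple `κ` of `(P, -Q)`. All unknowns become
  -- multiples of `κ`, and two compatibility conditions `hC`, `hA` remain, which `quad_bounds`
  -- refutes unless `κ = 0`.
  obtain ⟨κ, hκ⟩ : ∃ κ, l₁ = κ * P := ⟨l₁ / P, by field_simp⟩
  obtain ⟨ρ, hρ⟩ : ∃ ρ, P = ρ * Q := ⟨P / Q, by field_simp⟩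
  obtain ⟨σ, hσ⟩ : ∃ σ, Q = σ * P := ⟨Q / P, by field_simp⟩
  have hρσ : ρ * σ = 1 := by
    refine mul_right_cancel₀ hP0.ne' ?_
    rw [mul_assoc, ← hσ, ← hρ, one_mul]
  have hκ' : l₂ = -(κ * Q) := by
    refine mul_left_cancel₀ hP0.ne' ?_
    linear_combination e0 - Q * hκ
  have ha : a = m + κ * (1 - c / 2) + κ * (ρ * (c + 9 / 10) / 100) := by
    refine mul_left_cancel₀ hQ0.ne' ?_
    linear_combination -e1 / 10 + (c / 10 + 9 / 100) / 10 * hκ - (1 - c / 2) * hκ' +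
      κ * (c / 10 + 9 / 100) / 10 * hρ
  have hb : b = -(S * κ * (ρ - 1 / 2)) := by
    refine mul_left_cancel₀ hQ0.ne' ?_
    linear_combination 10 * e3 - S * hκ - S / 2 * hκ' - S * κ * hρ
  have hsb : S * a + c * b = -(S * κ * (1 - σ / 2)) := by
    refine mul_left_cancel₀ hP0.ne' ?_
    linear_combination 10 * e4 - S * hκ - S / 2 * hκ' + S * κ / 2 * hσ
  have hr : c * a - S * b = m + z - κ * (c - 3 / 2) + κ * (σ * (9 / 10 * c + 1) / 100) := by
    refine mul_left_cancel₀ hP0.ne' ?_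
    linear_combination e2 / 10 - (c - 3 / 2) * hκ - (9 / 100 * c + 1 / 10) / 10 * hκ' +
      κ * (9 / 100 * c + 1 / 10) / 10 * hσ
  obtain ⟨η, hη⟩ : ∃ η, η = ρ * (c + 9 / 10) / 100 := ⟨_, rfl⟩
  obtain ⟨θ, hθ⟩ : ∃ θ, θ = σ * (9 / 10 * c + 1) / 100 := ⟨_, rfl⟩
  rw [← hη] at ha
  rw [← hθ] at hr
  have hz₂ : z + 1 / 2 * m = -(κ * (1 + θ / 10)) := by
    linear_combination hκ' - hl₂ - hr / 10 - κ * hQ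
  have hz₁ : z = 1 / 2 * m + κ * (1 + η / 10) := by
    linear_combination hκ - hl₁ + ha / 10 + κ * hP
  have hm : m = -(κ * (2 + (η + θ) / 10)) := by linarith
  have hC : κ * (-(1 / 2 - c) * ((η + θ) / 10) + 9 / 10 * θ - c * η - S ^ 2 * ρ) = 0 := by
    linear_combination -hr + c * ha - S * hb - hz₂ + (c - 1 / 2) * hm - κ / 2 * hcs
  have hA : S * κ * (-((η + θ) / 10) + η - σ / 2 - c * ρ) = 0 := by
    linear_combination hsb - S * ha - c * hb - S * hm
  have hκ0 : κ = 0 := by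
    by_contra hκ0
    replace hC := (mul_eq_zero.mp hC).resolve_left hκ0
    have hρ1 : 1 ≤ ρ := by
      refine le_of_mul_le_mul_right ?_ hQ0
      rw [← hρ]
      linarith
    have hρ2 : ρ ≤ 17 / 15 := by
      refine le_of_mul_le_mul_right ?_ hQ0
      rw [← hρ]
      linarith
    have hσ1 : σ ≤ 1 := by
      refine le_of_mul_le_mul_right ?_ hP0
      rw [← hσ]
      linarith
    have hσ2 : 15 / 17 ≤ σ := by
      refine le_of_mul_le_mul_right ?_ hP0
      rw [← hσ]
      linarith
    exact quad_bounds hcs hc hρ1 hρ2 hσ1 hσ2 hη hθ hC fun hS =>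
      (mul_eq_zero.mp hA).resolve_left (mul_ne_zero hS hκ0)
  have hm0 : m = 0 := by rw [hm, hκ0]; ring
  exact ⟨by rw [ha, hκ0, hm0]; ring, by rw [hb, hκ0]; ring, by rw [hz₁, hκ0, hm0]; ring, hm0⟩

/-- For two points over the central parameter whose angles differ, the system for the generated
points has no solution, even at infinity. -/
theorem quadProfile_ker_trivial {φ : ℝ} (hφ : cos φ ≠ 1) (v : ℝ × ℝ × ℝ × ℝ)
    (hv : critForm quadProfile (1, 1, φ) v = 0) : v = 0 := by
  obtain ⟨a, b, z, m⟩ := v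
  have hcs := sin_sq_add_cos_sq φ
  simp only [critForm, redP, redQ, LinearMap.coe_mk, AddHom.coe_mk, sub_zero, Prod.mk_eq_zero,
    deriv_deriv_quadProfile] at hv
  simp only [deriv_quadProfile, quadProfile] at hv
  obtain ⟨e0, e1, e2, e3, e4⟩ := hv
  obtain ⟨h1, h2, h3, h4⟩ := quad_system_trivial hcs hφ rfl rfl rfl rfl
    (a := a) (b := b) (z := z) (m := m) (by linear_combination e0) (by linear_combination e1)
    (by linear_combination e2) (by linear_combination -e3) (by linear_combination e4)
  rw [h1, h2, h3, h4]
  rfl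

/-- The point generated by the two central points of the quadratic profile. -/
def quadCentre : Vec3 := ![1 - 2595 / 10019, 0, 0]

theorem critForm_quadCentre : critForm quadProfile (1, 1, 0) (frameCoord 0 quadCentre) = 0 := by
  -- At `t = 1` one has `h = 1 / 2`, `h' = 1 / 10`, `h'' = 10`, so `D = 10019 / 1000` and the shift
  -- in `critForm_diag_solution` is `-2595 / 10019`.
  have h0 : frameCoord 0 quadCentre = (1 - 2595 / 10019, 0, 0, 1) := by
    simp [frameCoord, quadCentre]
  simp only [critForm, redP, redQ, LinearMap.coe_mk, AddHom.coe_mk, sub_zero, Prod.mk_eq_zero,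
    deriv_deriv_quadProfile, h0]
  simp only [deriv_quadProfile, quadProfile]
  norm_num

theorem hasDerivAt_fderiv_redFun_line {h : ℝ → ℝ} {t : ℝ} (hh : ContDiff ℝ ∞ h) (θ : ℝ) (X : Vec3)
    (d e : ℝ × ℝ) :
    HasDerivAt (fun τ : ℝ => e.1 * (redPartS h ((t, θ), (t + τ * d.1, θ + τ * d.2)) X +
        redPartT h ((t, θ), (t + τ * d.1, θ + τ * d.2)) X) +
      e.2 * (redPartα h ((t, θ), (t + τ * d.1, θ + τ * d.2)) X +
        redPartβ h ((t, θ), (t + τ * d.1, θ + τ * d.2)) X))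
      (fderiv ℝ (fderiv ℝ fun w => redFun h w X) ((t, θ), (t, θ)) (0, d) (e, e)) 0 := by
  have h1 : ContDiffAt ℝ ∞ (fun w => redFun h w X) ((t, θ), (t, θ)) :=
    contDiffAt_partial (F := redFun h) (u₀ := (t, θ))
      (contDiffAt_uncurry_redFun hh.contDiffAt hh.contDiffAt X)
  have h2 : HasFDerivAt (fderiv ℝ fun w => redFun h w X)
      (fderiv ℝ (fderiv ℝ fun w => redFun h w X) ((t, θ), (t, θ))) ((t, θ), (t, θ)) :=
    ((h1.fderiv_right (m := 1) (by norm_cast)).differentiableAt (by simp)).hasFDerivAt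
  have hline : HasDerivAt (fun τ : ℝ => ((t, θ), (t + τ * d.1, θ + τ * d.2)))
      ((0 : ℝ × ℝ), d) 0 := by
    refine (hasDerivAt_const _ _).prodMk ?_
    have a1 := ((hasDerivAt_id' (0 : ℝ)).mul_const d.1).const_add t
    have a2 := ((hasDerivAt_id' (0 : ℝ)).mul_const d.2).const_add θ
    exact (a1.prodMk a2).congr_deriv (by simp)
  have h3 := HasFDerivAt.comp_hasDerivAt (f := fun τ : ℝ => ((t, θ), (t + τ * d.1, θ + τ * d.2)))
    0 (by simpa using h2) hline
  have h4 := h3.clm_apply (hasDerivAt_const 0 (e, e))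
  refine (h4.congr_of_eventuallyEq (Eventually.of_forall fun τ => ?_)).congr_deriv (by simp)
  simp only [Function.comp_apply]
  rw [fderiv_redFun_apply hh.contDiffAt hh.contDiffAt]
  ring

theorem quadProfile_offDiag_nondegenerate (d : ℝ × ℝ)
    (hd : ∀ e, fderiv ℝ (fderiv ℝ fun w => redFun quadProfile w quadCentre) ((1, 0), (1, 0))
      (0, d) (e, e) = 0) : d = 0 := by
  obtain ⟨d₁, d₂⟩ := d
  have key := fun e => hasDerivAt_fderiv_redFun_line (t := 1) contDiff_quadProfile 0 quadCentre
    (d₁, d₂) e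
  simp only [hd] at key
  -- In the sum of the angular derivatives the twist terms cancel, leaving a factor `sin (τ * d₂)`.
  have hd₂ : d₂ = 0 := by
    have k1 := key (0, 1)
    have hp : DifferentiableAt ℝ (fun τ : ℝ =>
        redP quadProfile ((1, 0), (1 + τ * d₁, 0 + τ * d₂)) *
          deriv quadProfile (1 + τ * d₁) * (-(1 - 2595 / 10019))) 0 := by
      simp only [redP, deriv_quadProfile, quadProfile]
      fun_prop
    have hs : HasDerivAt (fun τ : ℝ => sin (τ * d₂)) (cos (0 * d₂) * (1 * d₂)) 0 :=
      ((hasDerivAt_id' (0 : ℝ)).mul_const d₂).sin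
    have k2 := (hp.hasDerivAt.mul hs).unique (k1.congr_of_eventuallyEq
      (Eventually.of_forall fun τ => by
        simp [redPartα, redPartβ, quadCentre]
        ring))
    simp [redP, deriv_quadProfile, quadProfile] at k2
    norm_num at k2
    exact k2
  subst hd₂
  have k1 := key (1, 0)
  have i := (hasDerivAt_id' (0 : ℝ)).mul_const d₁
  -- The expansion of `redPartS + redPartT` in powers of `τ * d₁`; only its non-zero linear
  -- coefficient matters.
  have k2 := (((i.const_mul (-29583 / 20038)).add ((i.pow 2).const_mul (-14584083 / 200380))).add
    ((i.pow 3).const_mul (-55065 / 10019))).add ((i.pow 4).const_mul 250)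
  have k3 := k2.unique (k1.congr_of_eventuallyEq (Eventually.of_forall fun τ => by
    simp [redPartS, redPartT, redP, redQ, redL₁, redL₂, deriv_deriv_quadProfile, quadCentre]
    simp only [deriv_quadProfile, quadProfile]
    ring))
  norm_num at k3
  rw [k3]
  rfl

/-- Near the central pair of points, only points of the plane `z = 0` are generated. -/
theorem quadProfile_eventually_centre :
    ∀ᶠ w : (ℝ × ℝ) × (ℝ × ℝ) in 𝓝 ((1, 0), (1, 0)), ∀ X : Vec3,
      critForm quadProfile (w.1.1, w.2.1, w.1.2 - w.2.2) (frameCoord w.1.2 X) = 0 → X 2 = 0 := by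
  have hs : ∀ t, ContDiffAt ℝ ∞ quadProfile t := fun t => contDiff_quadProfile.contDiffAt
  have h0 : quadProfile 1 = 1 / 2 := by norm_num [quadProfile]
  have h1 : deriv quadProfile 1 = 1 / 10 := by norm_num [deriv_quadProfile]
  have h2 : deriv (deriv quadProfile) 1 = 10 := by rw [deriv_deriv_quadProfile]
  have hcrit := (critical_redFun_iff (w := ((1, 0), (1, 0))) (hs 1) (hs 1) quadCentre).mpr
    (by simpa using critForm_quadCentre)
  have hcore := eventually_critical_mem_plane (F := redFun quadProfile) (u₀ := (1, 0))
    (X₀ := quadCentre) (k := fun u => quadProfile u.1 * (2 - deriv quadProfile u.1) ^ 2)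
    (contDiffAt_uncurry_redFun (hs _) (hs _) quadCentre)
    (Eventually.of_forall fun u Y => redFun_diag quadProfile u Y)
    (by rw [h0, h1]; norm_num) hcrit.1 hcrit.2 quadProfile_offDiag_nondegenerate
  rw [nhds_prod_eq] at hcore
  obtain ⟨A, hA, B, hB, hAB⟩ := eventually_prod_iff.mp hcore
  have hker := critForm_diag_ker (h := quadProfile) (t := 1) (by rw [h0]; norm_num)
    (by rw [h1]; norm_num) (by rw [h1]; norm_num) (by rw [h0, h1, h2]; norm_num)
  filter_upwards [hA, eventually_generated_mem_nhds (hs 1) hker 0 critForm_quadCentre hB]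
    with w hwA hw X hX
  have hX' := (critical_redFun_iff (hs _) (hs _) X).mpr hX
  exact hAB hwA (hw X hX) hX'.1 hX'.2

/-- Near `φ = 0` the local argument applies; at any other angle in `[-π, π]` the trivial kernel
persists and excludes homogenising coordinate `1`. Compactness makes the neighbourhood of `(1, 1)`
uniform in `φ`. -/
theorem quadProfile_eventually_all_angles :
    ∀ᶠ p : ℝ × ℝ in 𝓝 (1, 1), ∀ φ ∈ Set.Icc (-π) π, ∀ a b z : ℝ,
      critForm quadProfile (p.1, p.2, φ) (a, b, z, 1) = 0 → z = 0 := by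
  refine isCompact_Icc.eventually_forall_of_forall_eventually fun φ hφ => ?_
  by_cases hφ0 : φ = 0
  · subst hφ0
    have hc : Continuous fun q : (ℝ × ℝ) × ℝ => ((q.1.1, q.2), (q.1.2, (0 : ℝ))) := by fun_prop
    filter_upwards [(hc.tendsto ((1, 1), 0)).eventually quadProfile_eventually_centre]
      with q hq a b z h
    have := hq (ofFrame q.2 (a, b, z, 1)) (by
      simpa only [sub_zero, frameCoord_ofFrame] using h)
    simpa [ofFrame] using this
  · have hcos : cos φ ≠ 1 := fun h => hφ0 <| by
      have h2 := pi_pos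
      exact (cos_eq_one_iff_of_lt_of_lt (by linarith [hφ.1]) (by linarith [hφ.2])).mp h
    have hker := eventually_ker_trivial (T := critForm quadProfile) (a := (1, 1, φ))
      (continuousAt_critForm contDiff_quadProfile.contDiffAt contDiff_quadProfile.contDiffAt)
      (quadProfile_ker_trivial hcos)
    have hc : Continuous fun q : (ℝ × ℝ) × ℝ => (q.1.1, q.1.2, q.2) := by fun_prop
    filter_upwards [(hc.tendsto ((1, 1), φ)).eventually hker] with q hq a b z h
    have := congrArg (fun v : ℝ × ℝ × ℝ × ℝ => v.2.2.2) (hq _ h)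
    simp at this

theorem critForm_toReal (h : ℝ → ℝ) (s t φ : ℝ) :
    critForm h (s, t, (φ : Real.Angle).toReal) = critForm h (s, t, φ) :=
  critForm_congr_angle h s t (by rw [Real.Angle.cos_toReal, Real.Angle.cos_coe])
    (by rw [Real.Angle.sin_toReal, Real.Angle.sin_coe])

theorem quadProfile_eventually_good :
    ∀ᶠ p : ℝ × ℝ in 𝓝 (1, 1), (0 < p.1 ∧ 0 < p.1 - quadProfile p.1 ∧ 0 < quadProfile p.1 ∧
      0 < deriv quadProfile p.1 ∧ deriv quadProfile p.1 < 2) ∧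
      (1 - deriv quadProfile p.2) * deriv quadProfile p.1 + deriv quadProfile p.2 ≠ 0 ∧
      (1 - deriv quadProfile p.2) * deriv quadProfile p.1 - deriv quadProfile p.2 ≠ 0 := by
  have hq : Continuous quadProfile := contDiff_quadProfile.continuous
  have hd : Continuous (deriv quadProfile) := by rw [deriv_quadProfile]; fun_prop
  have h0 : quadProfile 1 = 1 / 2 := by norm_num [quadProfile]
  have h1 : deriv quadProfile 1 = 1 / 10 := by norm_num [deriv_quadProfile]
  have gt_of : ∀ {F : ℝ × ℝ → ℝ}, Continuous F → 0 < F (1, 1) → ∀ᶠ p in 𝓝 (1, 1), 0 < F p :=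
    fun hF h => hF.tendsto _ |>.eventually_const_lt h
  have ne_of : ∀ {F : ℝ × ℝ → ℝ}, Continuous F → F (1, 1) ≠ 0 → ∀ᶠ p in 𝓝 (1, 1), F p ≠ 0 :=
    fun hF h => hF.continuousAt.eventually_ne h
  have e1 := gt_of (F := fun p => p.1) (by fun_prop) (by norm_num)
  have e2 := gt_of (F := fun p => p.1 - quadProfile p.1) (by fun_prop) (by norm_num [h0])
  have e3 := gt_of (F := fun p => quadProfile p.1) (by fun_prop) (by norm_num [h0])
  have e4 := gt_of (F := fun p => deriv quadProfile p.1) (by fun_prop) (by norm_num [h1])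
  have e5 := gt_of (F := fun p => 2 - deriv quadProfile p.1) (by fun_prop) (by norm_num [h1])
  have e6 := ne_of (F := fun p => (1 - deriv quadProfile p.2) * deriv quadProfile p.1 +
    deriv quadProfile p.2) (by fun_prop) (by norm_num [h1])
  have e7 := ne_of (F := fun p => (1 - deriv quadProfile p.2) * deriv quadProfile p.1 -
    deriv quadProfile p.2) (by fun_prop) (by norm_num [h1])
  filter_upwards [e1, e2, e3, e4, e5, e6, e7] with p p1 p2 p3 p4 p5 p6 p7
  exact ⟨⟨p1, p2, p3, p4, by linarith⟩, p6, p7⟩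

/-- A profile whose envelope lies globally in the plane `z = 0`. -/
theorem exists_global_example {lam : ℝ} (hlam : lam ≠ 0) :
    ∃ (I : Set ℝ) (f : ℝ → ℝ), ConvexProfile I f lam ∧
      (∀ u₁ ∈ rotDomain I, ∀ u₂ ∈ rotDomain I,
        Transversal (rotSurface₁ f) (rotSurface₂ f lam) (u₁, u₂)) ∧
      (∀ u ∈ rotDomain I, ∃ X, Generates (rotSurface₁ f) (rotSurface₂ f lam) (u, u) X) ∧
      EMH (rotSurface₁ f) (rotSurface₂ f lam) (rotDomain I) (rotDomain I) ⊆ {X | X 2 = 0} := by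
  obtain ⟨r, hr, hball⟩ := Metric.eventually_nhds_iff_ball.mp
    (quadProfile_eventually_good.and quadProfile_eventually_all_angles)
  have hprod : ∀ s ∈ Metric.ball (1 : ℝ) r, ∀ t ∈ Metric.ball (1 : ℝ) r,
      (s, t) ∈ Metric.ball ((1 : ℝ), (1 : ℝ)) r := fun s hs t ht => by
    rw [← ball_prod_same]
    exact ⟨hs, ht⟩
  have good := fun s hs t ht => (hball (s, t) (hprod s hs t ht)).1
  have plane := fun s hs t ht => (hball (s, t) (hprod s hs t ht)).2
  dsimp only at good plane
  set I := Metric.ball (1 : ℝ) r with hI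
  -- Dividing by `lam` makes the scaled profile equal to `quadProfile`, so one quadratic serves
  -- every `lam`.
  set f : ℝ → ℝ := fun t => lam⁻¹ * quadProfile t with hf
  have hlf : (fun t => lam * f t) = quadProfile := by
    funext t
    rw [hf]
    field_simp
  have hlf' : ∀ t, lam * f t = quadProfile t := fun t => congrFun hlf t
  have hdf : ∀ t, lam * deriv f t = deriv quadProfile t := fun t => by
    rw [← deriv_const_mul_field, hlf]
  have hsmooth : ContDiff ℝ ∞ f := contDiff_const.mul contDiff_quadProfile
  have hdiff : Differentiable ℝ f := hsmooth.differentiable (by simp)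
  have hp : ConvexProfile I f lam :=
    { isOpen := Metric.isOpen_ball
      nonempty := ⟨1, Metric.mem_ball_self hr⟩
      ordConnected := (convex_ball (1 : ℝ) r).ordConnected
      smooth := hsmooth.contDiffOn
      pos₁ := fun t ht => (good t ht t ht).1.1
      pos₂ := fun t ht => by rw [hlf']; exact (good t ht t ht).1.2.1
      ne_zero := fun t ht => mul_ne_zero (inv_ne_zero hlam) (good t ht t ht).1.2.2.1.ne'
      convex := fun t ht => by
        rw [hf, deriv_const_mul_fun, deriv_const_mul_field, deriv_deriv_quadProfile]
        have h1 := (good t ht t ht).1.2.2.2.1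
        have h2 : 0 < lam⁻¹ ^ 2 := by positivity
        calc (0 : ℝ) < lam⁻¹ ^ 2 * (deriv quadProfile t * 10) := by positivity
          _ = _ := by ring }
  have htrans : ∀ u₁ ∈ rotDomain I, ∀ u₂ ∈ rotDomain I,
      Transversal (rotSurface₁ f) (rotSurface₂ f lam) (u₁, u₂) := by
    rintro ⟨s, α⟩ ⟨hs, -⟩ ⟨t, β⟩ ⟨ht, -⟩
    obtain ⟨-, h1, h2⟩ := good s hs t ht
    refine transversal_of_slopes (hdiff s) (hdiff t) (hp.pos₁ s hs).ne' (hp.pos₂ t ht).ne'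
      (hp.deriv_ne_zero hs) (fun h0 => h1 ?_) (fun h0 => h2 ?_)
    · simp only [← hdf] at h0 ⊢
      linear_combination lam * h0
    · simp only [← hdf] at h0 ⊢
      linear_combination lam * h0
  refine ⟨I, f, hp, htrans, ?_, ?_⟩
  · rintro ⟨t, θ⟩ ht
    obtain ⟨-, -, g3, g4, g5⟩ := (good t ht.1 t ht.1).1
    have hD : deriv quadProfile t ^ 2 * (2 - deriv quadProfile t) +
        2 * quadProfile t * deriv (deriv quadProfile) t ≠ 0 := by
      rw [deriv_deriv_quadProfile]
      have : 0 < 2 - deriv quadProfile t := by linarith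
      positivity
    obtain ⟨x, hx⟩ := critForm_diag_solution hD
    refine ⟨ofFrame θ (x, 0, 0, 1), htrans _ ht _ ht, ?_⟩
    have hscale : scaleThird lam (ofFrame θ (x, 0, 0, 1)) = ofFrame θ (x, 0, 0, 1) := by
      ext i
      fin_cases i <;> simp [scaleThird, ofFrame]
    rw [critical_midPlaneFun_iff hlam hsmooth.contDiffAt hsmooth.contDiffAt
      (hp.pos₁ t ht.1).ne' (hp.pos₂ t ht.1).ne', hlf, hscale,
      critical_redFun_iff contDiff_quadProfile.contDiffAt contDiff_quadProfile.contDiffAt,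
      frameCoord_ofFrame]
    simpa using hx
  · rintro Y ⟨⟨s, α⟩, ⟨hs, -⟩, ⟨t, β⟩, ⟨ht, -⟩, -, hY⟩
    rw [critical_midPlaneFun_iff hlam hsmooth.contDiffAt hsmooth.contDiffAt
      (hp.pos₁ s hs).ne' (hp.pos₂ t ht).ne', hlf,
      critical_redFun_iff contDiff_quadProfile.contDiffAt contDiff_quadProfile.contDiffAt,
      ← critForm_toReal] at hY
    have h1 := plane s hs t ht _ ⟨(Real.Angle.neg_pi_lt_toReal _).le, Real.Angle.toReal_le_pi _⟩
      _ _ _ hY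
    simpa [scaleThird, hlam] using h1

end MidHyperplanes

end

theorem mainTheorem5 :
    -- every such pair of rotational surfaces
    (∀ (I : Set ℝ) (f : ℝ → ℝ) (lam : ℝ), lam ≠ 0 → MidHyperplanes.ConvexProfile I f lam →
      -- the mid-plane of two corresponding points is the plane `z = 0`
      (∀ u ∈ MidHyperplanes.rotDomain I,
        MidHyperplanes.Transversal (MidHyperplanes.rotSurface₁ f)
          (MidHyperplanes.rotSurface₂ f lam) (u, u) →
        MidHyperplanes.midPlane (MidHyperplanes.rotSurface₁ f)
          (MidHyperplanes.rotSurface₂ f lam) (u, u) = {X | X 2 = 0}) ∧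
      -- near a regular envelope point generated by two corresponding points, the EMH lies in the
      -- plane `z = 0`
      (∀ u ∈ MidHyperplanes.rotDomain I, ∀ X : MidHyperplanes.Vec3,
        MidHyperplanes.Generates (MidHyperplanes.rotSurface₁ f)
          (MidHyperplanes.rotSurface₂ f lam) (u, u) X →
        MidHyperplanes.HessianNondegenerate (MidHyperplanes.rotSurface₁ f)
          (MidHyperplanes.rotSurface₂ f lam) (u, u) X →
        ∃ V : Set (ℝ × ℝ), IsOpen V ∧ u ∈ V ∧ V ⊆ MidHyperplanes.rotDomain I ∧
          MidHyperplanes.EMH (MidHyperplanes.rotSurface₁ f)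
            (MidHyperplanes.rotSurface₂ f lam) V V ⊆ {Y | Y 2 = 0}) ∧
      -- no affine reflection takes `S₁` to `S₂`
      ¬ ∃ R : MidHyperplanes.Vec3 →ᵃ[ℝ] MidHyperplanes.Vec3,
        MidHyperplanes.IsAffineReflection R ∧
          R '' (MidHyperplanes.rotSurface₁ f '' MidHyperplanes.rotDomain I) =
            MidHyperplanes.rotSurface₂ f lam '' MidHyperplanes.rotDomain I) ∧
    -- the counter-example with the whole EMH in the plane `z = 0`
    (∀ lam : ℝ, lam ≠ 0 → ∃ (I : Set ℝ) (f : ℝ → ℝ), MidHyperplanes.ConvexProfile I f lam ∧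
      (∀ u₁ ∈ MidHyperplanes.rotDomain I, ∀ u₂ ∈ MidHyperplanes.rotDomain I,
        MidHyperplanes.Transversal (MidHyperplanes.rotSurface₁ f)
          (MidHyperplanes.rotSurface₂ f lam) (u₁, u₂)) ∧
      (∀ u ∈ MidHyperplanes.rotDomain I, ∃ X,
        MidHyperplanes.Generates (MidHyperplanes.rotSurface₁ f)
          (MidHyperplanes.rotSurface₂ f lam) (u, u) X) ∧
      MidHyperplanes.EMH (MidHyperplanes.rotSurface₁ f) (MidHyperplanes.rotSurface₂ f lam)
        (MidHyperplanes.rotDomain I) (MidHyperplanes.rotDomain I) ⊆ {X | X 2 = 0} ∧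
      ¬ ∃ R : MidHyperplanes.Vec3 →ᵃ[ℝ] MidHyperplanes.Vec3,
        MidHyperplanes.IsAffineReflection R ∧
          R '' (MidHyperplanes.rotSurface₁ f '' MidHyperplanes.rotDomain I) =
            MidHyperplanes.rotSurface₂ f lam '' MidHyperplanes.rotDomain I) := by
  refine ⟨fun I f lam hlam hp => ⟨fun u hu ht => MidHyperplanes.midPlane_diag hlam hp hu ht,
    fun u hu X hX hH => MidHyperplanes.exists_nhds_EMH_subset hlam hp hu hX hH, ?_⟩,
    fun lam hlam => ?_⟩
  · rintro ⟨R, hR, hS⟩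
    exact MidHyperplanes.no_affineReflection hR.1 hS hlam hp
  · obtain ⟨I, f, hp, h1, h2, h3⟩ := MidHyperplanes.exists_global_example hlam
    refine ⟨I, f, hp, h1, h2, h3, ?_⟩
    rintro ⟨R, hR, hS⟩
    exact MidHyperplanes.no_affineReflection hR.1 hS hlam hp
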